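/- Let $\mathcal D$ be the family of all dyadic cubes $Q=2^{-k}(m+[0,1)^n)$, $k\in\mathbb Z$, $m\in\mathbb Z^n$, in $\mathbb R^n$. Let $K:\mathcal D\to[0,\infty)$, let $\sigma_1,\sigma_2,\sigma_3$ be locally finite positive Borel measures on $\mathbb R^n$, and let $1<p_1,p_2,p_3<\infty$ with $\frac1{p_1}+\frac1{p_2}+\frac1{p_3}\ge1$. Write $p'=\frac p{p-1}$. For $Q\in\mathcal D$ and a Borel measure $\mu$, let $K(Q,\mu):\mathcal D\to[0,\infty]$ be the map with $K(Q,\mu)(Q')=K(Q')\mu(Q')$ if $Q'\subset Q$ and $K(Q,\mu)(Q')=0$ otherwise. For a map $L:\mathcal D\to[0,\infty]$ and Borel measures $\mu,\nu$, put $\overline L_\mu(Q)(x)=\frac1{\mu(Q)}\sum_{Q'\subset Q}L(Q')\mu(Q')1_{Q'}(x)$ for $x\in Q\in\mathcal D$, read as $0$ when $\mu(Q)=0$, and for $p>1$ define the discrete Wolff potential $$\mathcal W^p_{L,\mu}[\nu](x)=\sum_{Q\in\mathcal D}L(Q)\mu(Q)\left(\int_Q\overline L_\mu(Q)\,d\nu\right)^{p-1}1_Q(x).$$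 **Theorem 1.3.** The following two statements are equivalent. (a) There is a constant $c_1<\infty$ such that, for all (real- or complex-valued) $f_i\in L^{p_i}(\sigma_i)$, $i=1,2,3$, $$\sum_{Q\in\mathcal D}K(Q)\prod_{i=1}^3\left|\int_Qf_i\,d\sigma_i\right|\le c_1\prod_{i=1}^3\|f_i\|_{L^{p_i}(\sigma_i)}.$$ (b) There is a constant $c_2<\infty$ such that the following holds for every permutation $(a,b,c)$ of $(1,2,3)$ and every $Q\in\mathcal D$. If $\frac1{p_a}+\frac1{p_b}\ge1$, then $$\left(\int_Q\Big(\sum_{Q'\subset Q}K(Q,\sigma_c)(Q')\,\sigma_a(Q')1_{Q'}\Big)^{p_b'}d\sigma_b\right)^{1/p_b'}\le c_2\,\sigma_a(Q)^{1/p_a}\sigma_c(Q)^{1/p_c},$$ $$\left(\int_Q\Big(\sum_{Q'\subset Q}K(Q,\sigma_c)(Q')\,\sigma_b(Q')1_{Q'}\Big)^{p_a'}d\sigma_a\right)^{1/p_a'}\le c_2\,\sigma_b(Q)^{1/p_b}\sigma_c(Q)^{1/p_c}.$$ If $\frac1{p_a}+\frac1{p_b}<1$ and $r$ is given by $\frac1r+\frac1{p_a}+\frac1{p_b}=1$,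 then $$\left\|\mathcal W^{p_b'}_{K(Q,\sigma_c),\sigma_b}[\sigma_a]^{1/p_b'}\right\|_{L^r(\sigma_a)}\le c_2\,\sigma_c(Q)^{1/p_c},\qquad \left\|\mathcal W^{p_a'}_{K(Q,\sigma_c),\sigma_a}[\sigma_b]^{1/p_a'}\right\|_{L^r(\sigma_b)}\le c_2\,\sigma_c(Q)^{1/p_c}.$$ Moreover, when (a) and (b) hold, the least possible constants $c_1$ and $c_2$ exist and satisfy $c_1\le C c_2$ and $c_2\le C c_1$, with a constant $C$ that depends only on $p_1,p_2,p_3$. -/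

import Mathlib

open MeasureTheory
open scoped ENNReal NNReal

noncomputable section

namespace TrilinearEmbedding

/-- `Q ⊆ ℝⁿ` is a dyadic cube: `Q = 2^{-k} (m + [0,1)ⁿ)` for some `k ∈ ℤ`, `m ∈ ℤⁿ`. -/
def IsDyadicCube {n : ℕ} (Q : Set (Fin n → ℝ)) : Prop :=
  ∃ (k : ℤ) (m : Fin n → ℤ),
    Q = {x | ∀ i, (2 : ℝ) ^ (-k) * (m i : ℝ) ≤ x i ∧ x i < (2 : ℝ) ^ (-k) * ((m i : ℝ) + 1)}

/-- The family `𝓓` of all dyadic cubes in `ℝⁿ`. -/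
abbrev DyadicCube (n : ℕ) : Type := {Q : Set (Fin n → ℝ) // IsDyadicCube Q}

/-- The function `∑_{R ∈ 𝓓, R ⊆ Q} a(R) 1_R`. -/
def localSum {n : ℕ} (a : DyadicCube n → ℝ≥0∞) (Q : DyadicCube n) (x : Fin n → ℝ) : ℝ≥0∞ :=
  ∑' R : {R : DyadicCube n // R.1 ⊆ Q.1}, R.1.1.indicator (fun _ => a R.1) x

open Classical in
/-- The kernel `K(Q, μ)`: equal to `K(R) μ(R)` at the cubes `R ⊆ Q`, and to `0` at the others. -/
def localKernel {n : ℕ} (K : DyadicCube n → ℝ≥0∞) (Q : DyadicCube n)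
    (μ : Measure (Fin n → ℝ)) (R : DyadicCube n) : ℝ≥0∞ :=
  if R.1 ⊆ Q.1 then K R * μ R.1 else 0

open Classical in
/-- `K̄_μ(Q)(x) = μ(Q)⁻¹ ∑_{R ⊆ Q} K(R) μ(R) 1_R(x)`, understood as `0` when `μ(Q) = 0`. -/
def kernelBar {n : ℕ} (K : DyadicCube n → ℝ≥0∞) (μ : Measure (Fin n → ℝ))
    (Q : DyadicCube n) (x : Fin n → ℝ) : ℝ≥0∞ :=
  if μ Q.1 = 0 then 0 else (μ Q.1)⁻¹ * localSum (fun R => K R * μ R.1) Q x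

/-- The discrete Wolff potential
`𝓦^p_{K,μ}[ν](x) = ∑_{Q ∈ 𝓓} K(Q) μ(Q) (∫_Q K̄_μ(Q) dν)^{p-1} 1_Q(x)`. -/
def wolff {n : ℕ} (p : ℝ) (K : DyadicCube n → ℝ≥0∞) (μ ν : Measure (Fin n → ℝ))
    (x : Fin n → ℝ) : ℝ≥0∞ :=
  ∑' Q : DyadicCube n,
    Q.1.indicator (fun _ => K Q * μ Q.1 * (∫⁻ y in Q.1, kernelBar K μ Q y ∂ν) ^ (p - 1)) x

/-- The trilinear embedding inequality with constant `c`, for all `𝕜`-valued `f_i ∈ L^{p_i}(σ_i)`. -/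
def EmbeddingHolds (𝕜 : Type*) [RCLike 𝕜] {n : ℕ} (p : Fin 3 → ℝ) (K : DyadicCube n → ℝ≥0)
    (σ : Fin 3 → Measure (Fin n → ℝ)) (c : ℝ≥0) : Prop :=
  ∀ f : Fin 3 → (Fin n → ℝ) → 𝕜, (∀ i, MemLp (f i) (ENNReal.ofReal (p i)) (σ i)) →
    ∑' Q : DyadicCube n, (K Q : ℝ≥0∞) * ∏ i, ‖∫ x in Q.1, f i x ∂(σ i)‖ₑ
      ≤ (c : ℝ≥0∞) * ∏ i, eLpNorm (f i) (ENNReal.ofReal (p i)) (σ i)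

/-- One Sawyer type testing inequality at the cube `Q`:
`(∫_Q (∑_{R ⊆ Q} K(Q,σ_c)(R) σ_a(R) 1_R)^{p_b'} dσ_b)^{1/p_b'}
  ≤ C σ_a(Q)^{1/p_a} σ_c(Q)^{1/p_c}`. -/
def SawyerTest {n : ℕ} (p : Fin 3 → ℝ) (K : DyadicCube n → ℝ≥0)
    (σ : Fin 3 → Measure (Fin n → ℝ)) (C : ℝ≥0) (a b c : Fin 3) (Q : DyadicCube n) : Prop :=
  (∫⁻ x in Q.1,
      localSum (fun R => localKernel (fun S => (K S : ℝ≥0∞)) Q (σ c) R * σ a R.1) Q x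
        ^ (p b).conjExponent ∂(σ b)) ^ (1 / (p b).conjExponent)
    ≤ (C : ℝ≥0∞) * σ a Q.1 ^ (1 / p a) * σ c Q.1 ^ (1 / p c)

/-- One Wolff potential inequality at the cube `Q`:
`‖𝓦^{p_b'}_{K(Q,σ_c),σ_b}[σ_a]^{1/p_b'}‖_{L^r(σ_a)} ≤ C σ_c(Q)^{1/p_c}`. -/
def WolffBound {n : ℕ} (p : Fin 3 → ℝ) (K : DyadicCube n → ℝ≥0)
    (σ : Fin 3 → Measure (Fin n → ℝ)) (C : ℝ≥0) (r : ℝ) (a b c : Fin 3)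
    (Q : DyadicCube n) : Prop :=
  eLpNorm (fun x =>
      wolff (p b).conjExponent (localKernel (fun S => (K S : ℝ≥0∞)) Q (σ c)) (σ b) (σ a) x
        ^ (1 / (p b).conjExponent)) (ENNReal.ofReal r) (σ a)
    ≤ (C : ℝ≥0∞) * σ c Q.1 ^ (1 / p c)

/-- The localized condition with constant `C`: for every permutation `(a, b, c)` of the three
indices and every dyadic cube `Q`, the Sawyer type testing inequalities when
`1/p_a + 1/p_b ≥ 1`, and the Wolff potential inequalities when `1/p_a + 1/p_b < 1`. -/
def LocalConditionHolds {n : ℕ} (p : Fin 3 → ℝ) (K : DyadicCube n → ℝ≥0)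
    (σ : Fin 3 → Measure (Fin n → ℝ)) (C : ℝ≥0) : Prop :=
  ∀ (π : Equiv.Perm (Fin 3)) (a b c : Fin 3), a = π 0 → b = π 1 → c = π 2 →
    (1 ≤ 1 / p a + 1 / p b →
      ∀ Q : DyadicCube n, SawyerTest p K σ C a b c Q ∧ SawyerTest p K σ C b a c Q) ∧
    (1 / p a + 1 / p b < 1 →
      ∀ (Q : DyadicCube n) (r : ℝ), 1 / r + 1 / p a + 1 / p b = 1 →
        WolffBound p K σ C r a b c Q ∧ WolffBound p K σ C r b a c Q)

end TrilinearEmbedding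

end

open MeasureTheory
open scoped ENNReal NNReal

noncomputable section

namespace TrilinearEmbedding

/-! Everything is reduced to nonnegative functions, where the modulus disappears.

From (b) to (a): in a finite family of cubes, each `f i` gets principal cubes `π i Q ⊇ Q` with
levels `m i` such that the mean of `f i` over `Q` is at most `2 * m i (π i Q)` and `∑ m(F)^p σ(F) ≲
∫ f^p` (`exists_principal_carleson`). The three principal cubes of `Q` share `Q`, hence are nested,
and the sum splits into six orderings. When `π b Q ⊆ π a Q ⊆ π c Q`, freezing `F = π c Q` leaves a
bilinear sum with kernel `K σ_c` localized to `F`. The condition for the pair `(a, b)` bounds it by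
a multiple of `σ_c(F)^{1/p_c}` times the energies of `a` and `b` below `F` (`sum_le_of_sawyer`,
`sum_le_of_wolff`). The factor `m_c(F) σ_c(F)^{1/p_c}` is the `1/p_c` power of the energy of `c` at
`F`, so Hölder for sums over `F`, valid as `∑ 1/p_i ≥ 1`, closes the estimate.

From (a) to (b): the choice `f_c = 1_Q` gives a bilinear embedding with kernel `K(Q, σ_c)` and
constant `c₁ σ_c(Q)^{1/p_c}`. Duality and one more characteristic function give the Sawyer tests.
For the Wolff bound the potential is paired with `h ≥ 0`, and the embedding is applied to `(M
h)^{1/s}`, where `M` is the dyadic maximal function and `s = p_b'`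
(`BilinearEmbedding.lintegral_wolff_mul_le`).

Least constants exist because every inequality is a closed condition on its constant. -/

/-! ### Hölder inequalities, absorption, geometric sums and duality -/

theorem sum_rpow_le_rpow_sum {ι : Type*} (s : Finset ι) (u : ι → ℝ≥0∞) {θ : ℝ} (hθ : 1 ≤ θ) :
    ∑ j ∈ s, u j ^ θ ≤ (∑ j ∈ s, u j) ^ θ := by
  classical
  induction s using Finset.induction_on with
  | empty => simp
  | insert a s ha ih =>
    rw [Finset.sum_insert ha, Finset.sum_insert ha]
    exact (add_le_add le_rfl ih).trans (ENNReal.add_rpow_le_rpow_add _ _ hθ)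

theorem sum_prod_rpow_le_of_sum_eq_one {ι κ : Type*} [Fintype κ] (s : Finset ι)
    (u : κ → ι → ℝ≥0∞) (α : κ → ℝ) (hα : ∀ i, 0 ≤ α i) (h : ∑ i, α i = 1) :
    ∑ j ∈ s, ∏ i, u i j ^ α i ≤ ∏ i, (∑ j ∈ s, u i j) ^ α i := by
  let _ : MeasurableSpace s := ⊤
  have key := ENNReal.lintegral_prod_norm_pow_le (μ := (Measure.count : Measure s)) Finset.univ
    (f := fun i (j : s) => u i j) (fun i _ => (measurable_of_finite _).aemeasurable)
    (p := α) h (fun i _ => hα i)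
  simp only [lintegral_count, tsum_fintype] at key
  rw [← Finset.sum_coe_sort s]
  refine key.trans (le_of_eq ?_)
  refine Finset.prod_congr rfl fun i _ => ?_
  rw [← Finset.sum_coe_sort s]

/-- Hölder's inequality for finite sums, with exponents whose reciprocals sum to at least one. -/
theorem sum_prod_rpow_le {ι κ : Type*} [Fintype κ] (s : Finset ι)
    (u : κ → ι → ℝ≥0∞) (α : κ → ℝ) (hα : ∀ i, 0 ≤ α i) (h : 1 ≤ ∑ i, α i) :
    ∑ j ∈ s, ∏ i, u i j ^ α i ≤ ∏ i, (∑ j ∈ s, u i j) ^ α i := by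
  set θ := ∑ i, α i with hθ
  have hθ0 : θ ≠ 0 := by linarith
  -- Dividing all exponents by their sum `θ` leads to the classical case; the leftover outer power
  -- `θ ≥ 1` is superadditive.
  have e : ∀ x : ℝ≥0∞, ∀ i, x ^ α i = (x ^ (α i / θ)) ^ θ := fun x i => by
    rw [← ENNReal.rpow_mul, div_mul_cancel₀ _ hθ0]
  simp_rw [e, ENNReal.prod_rpow_of_nonneg (show (0 : ℝ) ≤ θ by linarith)]
  refine (sum_rpow_le_rpow_sum _ _ h).trans (ENNReal.rpow_le_rpow ?_ (by linarith))
  refine sum_prod_rpow_le_of_sum_eq_one s u (fun i => α i / θ)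
    (fun i => div_nonneg (hα i) (by linarith)) ?_
  rw [← Finset.sum_div, ← hθ, div_self hθ0]

theorem sum_rpow_mul_rpow_le {ι : Type*} (s : Finset ι) (u v : ι → ℝ≥0∞) {α β : ℝ}
    (hα : 0 ≤ α) (hβ : 0 ≤ β) (h : 1 ≤ α + β) :
    ∑ j ∈ s, u j ^ α * v j ^ β ≤ (∑ j ∈ s, u j) ^ α * (∑ j ∈ s, v j) ^ β := by
  have := sum_prod_rpow_le s ![u, v] ![α, β] (by simp [Fin.forall_fin_two, hα, hβ]) (by simpa)
  simpa using this

theorem sum_rpow_mul_rpow_mul_rpow_le {ι : Type*} (s : Finset ι) (u v w : ι → ℝ≥0∞) {α β γ : ℝ}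
    (hα : 0 ≤ α) (hβ : 0 ≤ β) (hγ : 0 ≤ γ) (h : 1 ≤ α + β + γ) :
    ∑ j ∈ s, u j ^ α * v j ^ β * w j ^ γ
      ≤ (∑ j ∈ s, u j) ^ α * (∑ j ∈ s, v j) ^ β * (∑ j ∈ s, w j) ^ γ := by
  have := sum_prod_rpow_le s ![u, v, w] ![α, β, γ]
    (by simp [Fin.forall_fin_succ, hα, hβ, hγ]) (by simpa [Fin.sum_univ_three])
  simpa [Fin.prod_univ_three] using this

/-- Hölder's inequality in the form `∫ u^α v^β ≤ (∫ u)^α (∫ v)^β`. -/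
theorem lintegral_rpow_mul_rpow_le {X : Type*} [MeasurableSpace X] {μ : Measure X}
    {u v : X → ℝ≥0∞} (hu : Measurable u) (hv : Measurable v) {α β : ℝ}
    (hα : 0 ≤ α) (hβ : 0 ≤ β) (h : α + β = 1) :
    ∫⁻ x, u x ^ α * v x ^ β ∂μ ≤ (∫⁻ x, u x ∂μ) ^ α * (∫⁻ x, v x ∂μ) ^ β := by
  have := ENNReal.lintegral_prod_norm_pow_le (μ := μ) Finset.univ (f := ![u, v])
    (by simp [Fin.forall_fin_two, hu.aemeasurable, hv.aemeasurable]) (p := ![α, β]) (by simpa)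
    (by simp [Fin.forall_fin_two, hα, hβ])
  simpa using this

/-- If `x ≤ A x^{1-1/p}` and `x` is finite, then `x ≤ A^p`. -/
theorem le_rpow_of_le_mul_rpow {x A : ℝ≥0∞} {p : ℝ} (hp : 0 < p) (hx : x ≠ ∞)
    (h : x ≤ A * x ^ (1 - 1 / p)) : x ≤ A ^ p := by
  rcases eq_or_ne x 0 with rfl | h0
  · simp
  have h1 : x ^ (1 / p) ≤ A := by
    have hne : x ^ (1 - 1 / p) ≠ 0 := by simp [h0, hx]
    have hnt : x ^ (1 - 1 / p) ≠ ∞ := by simp [h0, hx]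
    rw [← ENNReal.mul_le_mul_iff_left hne hnt, ← ENNReal.rpow_add _ _ h0 hx]
    simpa using h
  calc x = (x ^ (1 / p)) ^ p := by
        rw [← ENNReal.rpow_mul, one_div_mul_cancel hp.ne', ENNReal.rpow_one]
    _ ≤ A ^ p := ENNReal.rpow_le_rpow h1 hp.le

/-- The sum `∑_{j ≥ 0} 2^{-je}`. -/
def geomConst (e : ℝ) : ℝ≥0∞ := (1 - (2 : ℝ≥0∞) ^ (-e))⁻¹

theorem geomConst_ne_top {e : ℝ} (he : 0 < e) : geomConst e ≠ ∞ := by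
  unfold geomConst
  have : (2 : ℝ≥0∞) ^ (-e) < 1 :=
    ENNReal.rpow_lt_one_of_one_lt_of_neg (by norm_num) (by linarith)
  simpa [tsub_eq_zero_iff_le] using this

/-- After the largest power is factored out, the gaps to it are distinct natural numbers, so a
geometric series dominates. This is how distinct levels at a point are summed. -/
theorem sum_two_zpow_rpow_le {ι : Type*} (T : Finset ι) (l : ι → ℤ) (hl : Set.InjOn l T)
    {e : ℝ} (he : 0 < e) {B : ℝ≥0∞} (hB : ∀ i ∈ T, (2 : ℝ≥0∞) ^ l i ≤ B) :
    ∑ i ∈ T, ((2 : ℝ≥0∞) ^ l i) ^ e ≤ geomConst e * B ^ e := by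
  rcases T.eq_empty_or_nonempty with rfl | hT
  · simp
  obtain ⟨i₀, hi₀, hmax⟩ := T.exists_max_image l hT
  have hterm : ∀ i ∈ T, ((2 : ℝ≥0∞) ^ l i) ^ e
      = ((2 : ℝ≥0∞) ^ l i₀) ^ e * ((2 : ℝ≥0∞) ^ (-e)) ^ (l i₀ - l i).toNat := by
    intro i hi
    have h1 : ((l i₀ - l i).toNat : ℝ) = (l i₀ : ℝ) - l i := by
      have : ((l i₀ - l i).toNat : ℤ) = l i₀ - l i := Int.toNat_of_nonneg (by linarith [hmax i hi])
      exact_mod_cast this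
    simp only [← ENNReal.rpow_intCast, ← ENNReal.rpow_natCast, ← ENNReal.rpow_mul]
    rw [← ENNReal.rpow_add _ _ (by norm_num) (by norm_num), h1]
    congr 1
    ring
  rw [Finset.sum_congr rfl hterm, ← Finset.mul_sum, mul_comm]
  gcongr
  · have hinj : Set.InjOn (fun i => (l i₀ - l i).toNat) T := by
      intro i hi j hj hij
      apply hl hi hj
      have h1 := hmax i hi
      have h2 := hmax j hj
      simp only at hij
      omega
    rw [← Finset.sum_image (f := fun k : ℕ => ((2 : ℝ≥0∞) ^ (-e)) ^ k) hinj, geomConst,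
      ← ENNReal.tsum_geometric]
    exact ENNReal.sum_le_tsum _
  · exact hB i₀ hi₀

/-- The converse of Hölder's inequality for nonnegative functions. -/
theorem lintegral_rpow_le_of_forall_lintegral_mul_le {X : Type*} [MeasurableSpace X]
    {μ : Measure X} [SigmaFinite μ] {F : X → ℝ≥0∞} {p q : ℝ}
    (hpq : p.HolderConjugate q) {A : ℝ≥0∞}
    (h : ∀ g : X → ℝ≥0∞, Measurable g → ∫⁻ x, g x ^ p ∂μ ≠ ∞ →
      ∫⁻ x, F x * g x ∂μ ≤ A * (∫⁻ x, g x ^ p ∂μ) ^ (1 / p)) :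
    ∫⁻ x, F x ^ q ∂μ ≤ A ^ q := by
  have hq := hpq.symm.pos
  -- For `g ≤ F^q` of finite integral, the test function `g^{1/p}` gives `∫ g ≤ ∫ F g^{1/p} ≤ A (∫
  -- g)^{1/p}`, and the last factor is absorbed. Simple functions suffice, so `F` need not be
  -- measurable.
  have key : ∀ g : SimpleFunc X ℝ≥0, (∀ x, (g x : ℝ≥0∞) ≤ F x ^ q) →
      ∫⁻ x, g x ∂μ < ∞ → ∫⁻ x, g x ∂μ ≤ A ^ q := by
    intro g hg hfin
    have hgm : Measurable fun x => ((g x : ℝ≥0) : ℝ≥0∞) := g.measurable.coe_nnreal_ennreal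
    have e1 : ∀ x, ((g x : ℝ≥0∞) ^ (1 / p)) ^ p = g x := fun x => by
      rw [← ENNReal.rpow_mul, one_div_mul_cancel hpq.pos.ne', ENNReal.rpow_one]
    have h1 := h (fun x => (g x : ℝ≥0∞) ^ (1 / p)) (hgm.pow_const _) (by simpa only [e1] using hfin.ne)
    simp only [e1] at h1
    apply le_rpow_of_le_mul_rpow hq hfin.ne
    have e2 : 1 - 1 / q = 1 / p := by
      have := hpq.inv_add_inv_eq_one
      rw [one_div, one_div]; linarith
    rw [e2]
    refine le_trans (lintegral_mono fun x => ?_) h1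
    calc (g x : ℝ≥0∞) = (g x : ℝ≥0∞) ^ (1 / q) * (g x : ℝ≥0∞) ^ (1 / p) := by
          rw [← ENNReal.rpow_add_of_nonneg _ _ (by positivity) (one_div_nonneg.2 hpq.pos.le), ← e2]
          simp
      _ ≤ F x * (g x : ℝ≥0∞) ^ (1 / p) := by
          gcongr
          calc (g x : ℝ≥0∞) ^ (1 / q) ≤ (F x ^ q) ^ (1 / q) :=
                ENNReal.rpow_le_rpow (hg x) (by positivity)
            _ = F x := by rw [← ENNReal.rpow_mul, mul_one_div_cancel hq.ne', ENNReal.rpow_one]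
  rw [lintegral_eq_nnreal]
  refine iSup₂_le fun φ hφ => ?_
  refine le_of_forall_lt fun L hL => ?_
  have hL' : L < ∫⁻ x, φ x ∂μ := by
    have := SimpleFunc.lintegral_eq_lintegral (φ.map ((↑) : ℝ≥0 → ℝ≥0∞)) μ
    rw [← this] at hL
    simpa using hL
  obtain ⟨g, hgφ, hgfin, hLg⟩ := SimpleFunc.exists_lt_lintegral_simpleFunc_of_lt_lintegral hL'
  exact hLg.trans_le (key g (fun x => le_trans (by exact_mod_cast hgφ x) (hφ x)) hgfin)

/-! ### Dyadic cubes, principal cubes and the Carleson embedding -/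

section Cubes

variable {n : ℕ}

theorem DyadicCube.nonempty (Q : DyadicCube n) : Q.1.Nonempty := by
  obtain ⟨_, k, m, rfl⟩ := Q
  refine ⟨fun i => (2 : ℝ) ^ (-k) * m i, fun i => ⟨le_rfl, ?_⟩⟩
  have : (0 : ℝ) < 2 ^ (-k) := by positivity
  nlinarith

theorem DyadicCube.measurableSet (Q : DyadicCube n) : MeasurableSet Q.1 := by
  obtain ⟨_, k, m, rfl⟩ := Q
  simp only [Set.ofPred_forall, Set.ofPred_and]
  refine MeasurableSet.iInter fun i => ?_
  exact (measurableSet_le measurable_const (measurable_pi_apply i)).inter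
    (measurableSet_lt (measurable_pi_apply i) measurable_const)

theorem DyadicCube.measure_ne_top (Q : DyadicCube n) (σ : Measure (Fin n → ℝ))
    [IsLocallyFiniteMeasure σ] : σ Q.1 ≠ ∞ := by
  obtain ⟨_, k, m, rfl⟩ := Q
  refine ne_top_of_le_ne_top
    (isCompact_Icc (a := fun i => (2 : ℝ) ^ (-k) * m i)
      (b := fun i => (2 : ℝ) ^ (-k) * (m i + 1))).measure_lt_top.ne (measure_mono ?_)
  exact fun x hx => ⟨fun i => (hx i).1, fun i => (hx i).2.le⟩

instance : Countable (DyadicCube n) := by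
  have : Function.Surjective (fun a : ℤ × (Fin n → ℤ) =>
      (⟨_, a.1, a.2, rfl⟩ : DyadicCube n)) := by
    rintro ⟨_, k, m, rfl⟩
    exact ⟨(k, m), rfl⟩
  exact this.countable

theorem DyadicCube.subset_or_subset (Q R : DyadicCube n) (h : (Q.1 ∩ R.1).Nonempty) :
    Q.1 ⊆ R.1 ∨ R.1 ⊆ Q.1 := by
  have key : ∀ (k : ℤ) (j : ℕ) (m m' : Fin n → ℤ) (x : Fin n → ℝ),
      (∀ i, (2 : ℝ) ^ (-k) * (m i : ℝ) ≤ x i ∧ x i < (2 : ℝ) ^ (-k) * ((m i : ℝ) + 1)) →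
      (∀ i, (2 : ℝ) ^ (-(k + j)) * (m' i : ℝ) ≤ x i ∧
        x i < (2 : ℝ) ^ (-(k + j)) * ((m' i : ℝ) + 1)) →
      ∀ y : Fin n → ℝ, (∀ i, (2 : ℝ) ^ (-(k + j)) * (m' i : ℝ) ≤ y i ∧
        y i < (2 : ℝ) ^ (-(k + j)) * ((m' i : ℝ) + 1)) →
      ∀ i, (2 : ℝ) ^ (-k) * (m i : ℝ) ≤ y i ∧ y i < (2 : ℝ) ^ (-k) * ((m i : ℝ) + 1) := by
    intro k j m m' x hx hx' y hy i
    have hd : (0 : ℝ) < 2 ^ (-(k + j)) := by positivity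
    have e : (2 : ℝ) ^ (-k) = 2 ^ (-(k + j)) * 2 ^ j := by
      rw [← zpow_natCast, ← zpow_add₀ (by norm_num)]; congr 1; ring
    obtain ⟨h1, h2⟩ := hx i
    obtain ⟨h3, h4⟩ := hx' i
    obtain ⟨h5, h6⟩ := hy i
    rw [e, mul_assoc] at h1 h2 ⊢
    -- In units of the finer side length all endpoints are integers, so the strict inequalities at
    -- the common point `x` sharpen to containment of the whole finer cube.
    have h7 : (2 : ℤ) ^ j * m i < m' i + 1 := by
      have := lt_of_mul_lt_mul_left (h1.trans_lt h4) hd.le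
      exact_mod_cast this
    have h8 : m' i < (2 : ℤ) ^ j * (m i + 1) := by
      have := lt_of_mul_lt_mul_left (h3.trans_lt h2) hd.le
      exact_mod_cast this
    have h7' : (2 : ℝ) ^ j * m i ≤ m' i := by exact_mod_cast Int.lt_add_one_iff.1 h7
    have h8' : (m' i : ℝ) + 1 ≤ (2 : ℝ) ^ j * (m i + 1) := by exact_mod_cast h8
    rw [mul_assoc]
    exact ⟨(mul_le_mul_of_nonneg_left h7' hd.le).trans h5,
      h6.trans_le (mul_le_mul_of_nonneg_left h8' hd.le)⟩
  obtain ⟨_, k, m, rfl⟩ := Q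
  obtain ⟨_, l, m', rfl⟩ := R
  obtain ⟨x, hx, hx'⟩ := h
  rcases le_total k l with hkl | hkl
  · obtain ⟨j, rfl⟩ := Int.le.dest hkl
    exact Or.inr (key k j m m' x hx hx')
  · obtain ⟨j, rfl⟩ := Int.le.dest hkl
    exact Or.inl (key l j m' m x hx' hx)

theorem DyadicCube.subset_or_subset_of_subset {P Q R : DyadicCube n} (hQ : P.1 ⊆ Q.1)
    (hR : P.1 ⊆ R.1) : Q.1 ⊆ R.1 ∨ R.1 ⊆ Q.1 :=
  Q.subset_or_subset R (P.nonempty.mono fun _ hx => ⟨hQ hx, hR hx⟩)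

/-- The mean value of `f` over `Q`, equal to `0` when `σ(Q) = 0`. -/
def average (σ : Measure (Fin n → ℝ)) (f : (Fin n → ℝ) → ℝ≥0∞) (Q : DyadicCube n) : ℝ≥0∞ :=
  (σ Q.1)⁻¹ * ∫⁻ x in Q.1, f x ∂σ

theorem average_mul_measure (σ : Measure (Fin n → ℝ)) [IsLocallyFiniteMeasure σ]
    (f : (Fin n → ℝ) → ℝ≥0∞) (Q : DyadicCube n) :
    average σ f Q * σ Q.1 = ∫⁻ x in Q.1, f x ∂σ := by
  rcases eq_or_ne (σ Q.1) 0 with h | h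
  · simp [average, h, Measure.restrict_eq_zero.2 h]
  · rw [average, mul_comm, ← mul_assoc, ENNReal.mul_inv_cancel h (Q.measure_ne_top σ), one_mul]

theorem setLIntegral_ne_top_of_rpow {σ : Measure (Fin n → ℝ)} [IsLocallyFiniteMeasure σ]
    {f : (Fin n → ℝ) → ℝ≥0∞} (hf : Measurable f) {p : ℝ} (hp : 1 < p)
    (hfin : ∫⁻ x, f x ^ p ∂σ ≠ ∞) (Q : DyadicCube n) : ∫⁻ x in Q.1, f x ∂σ ≠ ∞ := by
  have h := lintegral_rpow_mul_rpow_le (μ := σ.restrict Q.1) (hf.pow_const p)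
    (measurable_const (a := (1 : ℝ≥0∞))) (α := 1 / p) (β := 1 - 1 / p) (by positivity)
    (sub_nonneg.2 ((div_le_one (by linarith)).2 hp.le)) (by ring)
  have e1 : ∀ x, (f x ^ p) ^ (1 / p) = f x := fun x => by
    rw [← ENNReal.rpow_mul, mul_one_div_cancel (by linarith), ENNReal.rpow_one]
  simp only [e1, ENNReal.one_rpow, mul_one, lintegral_const, Measure.restrict_apply_univ,
    one_mul] at h
  refine ne_top_of_le_ne_top (ENNReal.mul_ne_top ?_ ?_) h
  · exact ENNReal.rpow_ne_top_of_nonneg (by positivity)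
      (ne_top_of_le_ne_top hfin (setLIntegral_le_lintegral _ _))
  · exact ENNReal.rpow_ne_top_of_nonneg
      (sub_nonneg.2 ((div_le_one (by linarith)).2 hp.le)) (Q.measure_ne_top σ)

/-- Principal cubes of a finite family: `π Q` is the largest cube above `Q` at which the largest
mean value seen from `Q` has the same binary order of magnitude. -/
theorem exists_principal (S : Finset (DyadicCube n)) (w : DyadicCube n → ℝ≥0∞)
    (h0 : ∀ Q ∈ S, w Q ≠ 0) (ht : ∀ Q ∈ S, w Q ≠ ∞) :
    ∃ (π : DyadicCube n → DyadicCube n) (l : DyadicCube n → ℤ),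
      (∀ Q ∈ S, π Q ∈ S ∧ Q.1 ⊆ (π Q).1 ∧ w Q ≤ 2 * 2 ^ l (π Q) ∧ 2 ^ l (π Q) ≤ w (π Q)) ∧
      (∀ Q ∈ S, ∀ R ∈ S, Q.1 ⊆ R.1 → R.1 ⊆ (π Q).1 → π R = π Q) ∧
      (∀ Q ∈ S, ∀ R ∈ S, l (π Q) = l (π R) → ((π Q).1 ∩ (π R).1).Nonempty → π Q = π R) := by
  classical
  -- `M Q` is the largest value of `w` on the cubes of `S` above `Q`. It is monotone along chains,
  -- so the cubes above `Q` with the binary order `l Q` form an interval, whose top is `π Q`.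
  set M : DyadicCube n → ℝ≥0∞ := fun Q => (S.filter (Q.1 ⊆ ·.1)).sup w with hM
  have hwM : ∀ Q ∈ S, w Q ≤ M Q := fun Q hQ =>
    Finset.le_sup (f := w) (by simp [hQ])
  have hM0 : ∀ Q ∈ S, M Q ≠ 0 := fun Q hQ h => h0 Q hQ (le_antisymm (h ▸ hwM Q hQ) bot_le)
  have hMt : ∀ Q, M Q ≠ ∞ := fun Q => by
    refine ne_of_lt ((Finset.sup_lt_iff (by simp)).2 fun R hR => ?_)
    exact (ht R (Finset.mem_filter.1 hR).1).lt_top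
  have hMattain : ∀ Q ∈ S, ∃ R ∈ S, Q.1 ⊆ R.1 ∧ M Q = w R := fun Q hQ => by
    obtain ⟨R, hR, h⟩ := Finset.exists_mem_eq_sup (S.filter (Q.1 ⊆ ·.1)) ⟨Q, by simp [hQ]⟩ w
    exact ⟨R, (Finset.mem_filter.1 hR).1, (Finset.mem_filter.1 hR).2, h⟩
  have hMmono : ∀ Q R : DyadicCube n, Q.1 ⊆ R.1 → M R ≤ M Q := fun Q R h =>
    Finset.sup_mono fun T hT => by
      simp only [Finset.mem_filter] at hT ⊢
      exact ⟨hT.1, h.trans hT.2⟩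
  have hl : ∀ Q ∈ S, ∃ l : ℤ, M Q ∈ Set.Ico ((2 : ℝ≥0∞) ^ l) (2 ^ (l + 1)) := fun Q hQ =>
    ENNReal.exists_mem_Ico_zpow (hM0 Q hQ) (hMt Q) (by norm_num) (by norm_num)
  choose! l hl1 hl2 using hl
  have hlmono : ∀ Q ∈ S, ∀ R ∈ S, Q.1 ⊆ R.1 → l R ≤ l Q := by
    intro Q hQ R hR h
    by_contra hlt
    have h1 : (2 : ℝ≥0∞) ^ (l Q + 1) ≤ 2 ^ l R :=
      ENNReal.zpow_le_of_le (by norm_num) (by omega)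
    exact absurd ((hl2 Q hQ).trans_le (h1.trans (hl1 R hR))) (not_lt.2 (hMmono Q R h))
  have hπ : ∀ Q ∈ S, ∃ P ∈ S, Q.1 ⊆ P.1 ∧ l P = l Q ∧
      ∀ R ∈ S, Q.1 ⊆ R.1 → l R = l Q → R.1 ⊆ P.1 := by
    intro Q hQ
    obtain ⟨P, hQP, hP⟩ := Finset.exists_le_maximal (a := Q)
      (S.filter fun R => Q.1 ⊆ R.1 ∧ l R = l Q) (by simp [hQ])
    have hP' := Finset.mem_filter.1 hP.1
    refine ⟨P, hP'.1, hQP, hP'.2.2, fun R hR hQR hlR => ?_⟩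
    rcases DyadicCube.subset_or_subset_of_subset hP'.2.1 hQR with h | h
    · exact hP.2 (Finset.mem_filter.2 ⟨hR, hQR, hlR⟩) h
    · exact h
  choose! π hπS hQπ hlπ hπmax using hπ
  have hcons : ∀ Q ∈ S, ∀ R ∈ S, Q.1 ⊆ R.1 → l R = l Q → π R = π Q := by
    intro Q hQ R hR hQR hlR
    refine Subtype.ext (Set.Subset.antisymm ?_ ?_)
    · exact hπmax Q hQ _ (hπS R hR) (hQR.trans (hQπ R hR)) ((hlπ R hR).trans hlR)
    · refine hπmax R hR _ (hπS Q hQ) ?_ ((hlπ Q hQ).trans hlR.symm)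
      exact (hπmax Q hQ R hR hQR hlR)
  refine ⟨π, l, fun Q hQ => ⟨hπS Q hQ, hQπ Q hQ, ?_, ?_⟩, ?_, ?_⟩
  · rw [hlπ Q hQ]
    calc w Q ≤ M Q := hwM Q hQ
      _ ≤ 2 ^ (l Q + 1) := (hl2 Q hQ).le
      _ = 2 * 2 ^ l Q := by
        rw [ENNReal.zpow_add (by norm_num) (by norm_num), zpow_one, mul_comm]
  -- A cube `R` above `π Q` where the maximum is attained has the same order, so maximality forces
  -- `R = π Q`: the maximum is attained at the principal cube itself.
  · obtain ⟨R, hR, hπR, hMR⟩ := hMattain (π Q) (hπS Q hQ)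
    have hlR : l R = l (π Q) := by
      refine le_antisymm (hlmono _ (hπS Q hQ) _ hR hπR) ?_
      by_contra hlt
      have h1 : (2 : ℝ≥0∞) ^ (l R + 1) ≤ 2 ^ l (π Q) :=
        ENNReal.zpow_le_of_le (by norm_num) (by omega)
      have h2 := (hl2 R hR).trans_le (h1.trans (hl1 _ (hπS Q hQ)))
      rw [hMR] at h2
      exact absurd h2 (not_lt.2 (hwM R hR))
    have : R = π Q := Subtype.ext (Set.Subset.antisymm
      (hπmax Q hQ R hR ((hQπ Q hQ).trans hπR) (hlR.trans (hlπ Q hQ))) hπR)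
    rw [this] at hMR
    exact hMR ▸ hl1 _ (hπS Q hQ)
  · intro Q hQ R hR hQR hRπ
    refine hcons Q hQ R hR hQR (le_antisymm (hlmono Q hQ R hR hQR) ?_)
    exact hlπ Q hQ ▸ hlmono R hR _ (hπS Q hQ) hRπ
  · intro Q hQ R hR hlQR hne
    have hππ : ∀ Q ∈ S, π (π Q) = π Q := fun Q hQ => hcons Q hQ _ (hπS Q hQ) (hQπ Q hQ) (hlπ Q hQ)
    rcases DyadicCube.subset_or_subset _ _ hne with h | h
    · have := hcons _ (hπS Q hQ) _ (hπS R hR) h hlQR.symm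
      rw [hππ Q hQ, hππ R hR] at this
      exact this.symm
    · have := hcons _ (hπS R hR) _ (hπS Q hQ) h hlQR
      rwa [hππ Q hQ, hππ R hR] at this

/-- The constant of the Carleson embedding over principal cubes. -/
def carlesonConst (p : ℝ) : ℝ≥0∞ := geomConst (p - 1) ^ p

theorem carlesonConst_ne_top {p : ℝ} (hp : 1 < p) : carlesonConst p ≠ ∞ :=
  ENNReal.rpow_ne_top_of_nonneg (by linarith) (geomConst_ne_top (by linarith))

/-- Principal cubes of `f` in a finite family, with the Carleson embedding over them. -/
theorem exists_principal_carleson (σ : Measure (Fin n → ℝ)) [IsLocallyFiniteMeasure σ]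
    {p : ℝ} (hp : 1 < p) {f : (Fin n → ℝ) → ℝ≥0∞} (hf : Measurable f)
    (hfin : ∫⁻ x, f x ^ p ∂σ ≠ ∞) (S : Finset (DyadicCube n))
    (hS : ∀ Q ∈ S, ∫⁻ x in Q.1, f x ∂σ ≠ 0) :
    ∃ (π : DyadicCube n → DyadicCube n) (m : DyadicCube n → ℝ≥0∞),
      (∀ Q ∈ S, π Q ∈ S ∧ Q.1 ⊆ (π Q).1 ∧ average σ f Q ≤ 2 * m (π Q)) ∧
      (∀ Q ∈ S, ∀ R ∈ S, Q.1 ⊆ R.1 → R.1 ⊆ (π Q).1 → π R = π Q) ∧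
      ∀ T : Finset (DyadicCube n), (∀ F ∈ T, ∃ Q ∈ S, π Q = F) →
        ∑ F ∈ T, m F ^ p * σ F.1 ≤ carlesonConst p * ∫⁻ x, f x ^ p ∂σ := by
  classical
  have hfQ := setLIntegral_ne_top_of_rpow hf hp hfin
  obtain ⟨π, l, h1, h2, h3⟩ := exists_principal S (average σ f)
    (fun Q hQ h => hS Q hQ (by rw [← average_mul_measure, h, zero_mul]))
    (fun Q hQ => ENNReal.mul_ne_top (fun h => hS Q hQ (by
      simp [Measure.restrict_eq_zero.2 (ENNReal.inv_eq_top.1 h)])) (hfQ Q))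
  refine ⟨π, fun F => 2 ^ l F, fun Q hQ => ⟨(h1 Q hQ).1, (h1 Q hQ).2.1, (h1 Q hQ).2.2.1⟩, h2,
    fun T hT => ?_⟩
  set m : DyadicCube n → ℝ≥0∞ := fun F => 2 ^ l F with hm
  have hmt : ∀ F, m F ≠ ∞ := fun F => by simp [hm, ← ENNReal.rpow_intCast]
  set E := ∑ F ∈ T, m F ^ p * σ F.1 with hE
  have hEt : E ≠ ∞ := ENNReal.sum_ne_top.2 fun F _ => ENNReal.mul_ne_top
    (ENNReal.rpow_ne_top_of_nonneg (by linarith) (hmt F)) (F.measure_ne_top σ)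
  set φ : (Fin n → ℝ) → ℝ≥0∞ := fun x => ∑ F ∈ T, F.1.indicator (fun _ => m F ^ p) x with hφ
  have hφm : Measurable φ :=
    Finset.measurable_fun_sum _ fun F _ => measurable_const.indicator F.measurableSet
  have hφE : ∫⁻ x, φ x ∂σ = E := by
    rw [lintegral_finsetSum _ fun F _ => measurable_const.indicator F.measurableSet]
    simp [hE, DyadicCube.measurableSet]
  -- Two principal cubes of equal level that meet coincide, so the levels at `x` are distinct. Each
  -- is at most `φ(x)^{1/p}`, and their powers sum geometrically.
  have hpt : ∀ x, ∑ F ∈ T, F.1.indicator (fun _ => m F ^ (p - 1)) x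
      ≤ geomConst (p - 1) * φ x ^ (1 - 1 / p) := by
    intro x
    have hle : ∀ F ∈ T.filter (x ∈ ·.1), (2 : ℝ≥0∞) ^ l F ≤ φ x ^ (1 / p) := by
      intro F hF
      rw [Finset.mem_filter] at hF
      rw [one_div, ENNReal.le_rpow_inv_iff (by linarith)]
      calc m F ^ p = F.1.indicator (fun _ => m F ^ p) x := by simp [hF.2]
        _ ≤ φ x := Finset.single_le_sum (f := fun F : DyadicCube n =>
            F.1.indicator (fun _ => m F ^ p) x) (fun _ _ => bot_le) hF.1
    have hinj : Set.InjOn l (T.filter (x ∈ ·.1)) := by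
      intro F hF G hG hl
      simp only [Finset.coe_filter, Set.mem_ofPred_eq] at hF hG
      obtain ⟨Q, hQ, rfl⟩ := hT F hF.1
      obtain ⟨R, hR, rfl⟩ := hT G hG.1
      exact h3 Q hQ R hR hl ⟨x, hF.2, hG.2⟩
    have := sum_two_zpow_rpow_le _ l hinj (e := p - 1) (by linarith) hle
    rw [← ENNReal.rpow_mul, show 1 / p * (p - 1) = 1 - 1 / p by field_simp] at this
    simpa [Set.indicator_apply, Finset.sum_filter] using this
  -- Replacing one factor `m F` by the mean of `f` over `F` turns `E` into an integral of `f`;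
  -- Hölder returns `E^{1-1/p}`, absorbed below because `E` is finite.
  have hmain : E ≤ geomConst (p - 1) * (∫⁻ x, f x ^ p ∂σ) ^ (1 / p) * E ^ (1 - 1 / p) := by
    have e1 : ∀ x, (f x ^ p) ^ (1 / p) = f x := fun x => by
      rw [← ENNReal.rpow_mul, mul_one_div_cancel (by linarith), ENNReal.rpow_one]
    calc E ≤ ∑ F ∈ T, m F ^ (p - 1) * ∫⁻ x in F.1, f x ∂σ := by
          refine Finset.sum_le_sum fun F hF => ?_
          obtain ⟨Q, hQ, rfl⟩ := hT F hF
          rw [← average_mul_measure, ← mul_assoc]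
          gcongr
          calc m (π Q) ^ p = m (π Q) ^ (p - 1) * m (π Q) := by
                nth_rw 3 [← ENNReal.rpow_one (m (π Q))]
                rw [← ENNReal.rpow_add_of_nonneg _ _ (by linarith) zero_le_one]
                simp
            _ ≤ _ := by gcongr; exact (h1 Q hQ).2.2.2
      _ = ∫⁻ x, f x * ∑ F ∈ T, F.1.indicator (fun _ => m F ^ (p - 1)) x ∂σ := by
          simp_rw [Finset.mul_sum]
          rw [lintegral_finsetSum T (f := fun F x => f x * F.1.indicator (fun _ => m F ^ (p - 1)) x)
            fun F _ => hf.mul (measurable_const.indicator F.measurableSet)]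
          refine Finset.sum_congr rfl fun F _ => ?_
          rw [← lintegral_const_mul _ hf, ← lintegral_indicator F.measurableSet]
          refine lintegral_congr fun x => ?_
          by_cases hx : x ∈ F.1 <;> simp [hx, mul_comm]
      _ ≤ ∫⁻ x, geomConst (p - 1) * ((f x ^ p) ^ (1 / p) * φ x ^ (1 - 1 / p)) ∂σ := by
          refine lintegral_mono fun x => ?_
          rw [e1, mul_left_comm]
          exact mul_le_mul_right (hpt x) _
      _ = geomConst (p - 1) * ∫⁻ x, (f x ^ p) ^ (1 / p) * φ x ^ (1 - 1 / p) ∂σ :=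
          lintegral_const_mul _ (((hf.pow_const _).pow_const _).mul (hφm.pow_const _))
      _ ≤ _ := by
          rw [mul_assoc, ← hφE]
          gcongr
          exact lintegral_rpow_mul_rpow_le (hf.pow_const _) hφm (by positivity)
            (sub_nonneg.2 ((div_le_one (by linarith)).2 hp.le)) (by ring)
  refine (le_rpow_of_le_mul_rpow (by linarith) hEt hmain).trans_eq ?_
  rw [ENNReal.mul_rpow_of_nonneg _ _ (by linarith), ← ENNReal.rpow_mul,
    one_div_mul_cancel (by linarith), ENNReal.rpow_one, carlesonConst]

end Cubes

/-! ### The dyadic maximal theorem -/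

section Maximal

variable {n : ℕ}

/-- The dyadic maximal function. -/
def maximalFn (σ : Measure (Fin n → ℝ)) (f : (Fin n → ℝ) → ℝ≥0∞) (x : Fin n → ℝ) : ℝ≥0∞ :=
  ⨆ Q : DyadicCube n, Q.1.indicator (fun _ => average σ f Q) x

theorem measurable_maximalFn (σ : Measure (Fin n → ℝ)) (f : (Fin n → ℝ) → ℝ≥0∞) :
    Measurable (maximalFn σ f) :=
  Measurable.iSup fun Q => measurable_const.indicator Q.measurableSet

theorem average_le_maximalFn (σ : Measure (Fin n → ℝ)) (f : (Fin n → ℝ) → ℝ≥0∞)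
    {Q : DyadicCube n} {x : Fin n → ℝ} (hx : x ∈ Q.1) : average σ f Q ≤ maximalFn σ f x := by
  refine le_trans ?_ (le_iSup _ Q)
  simp [hx]

/-- The constant of the maximal inequality in `L^p`. -/
def maximalConst (p : ℝ) : ℝ≥0∞ := 2 ^ p * carlesonConst p

theorem maximalConst_ne_top {p : ℝ} (hp : 1 < p) : maximalConst p ≠ ∞ :=
  ENNReal.mul_ne_top (ENNReal.rpow_ne_top_of_nonneg (by linarith) (by norm_num))
    (carlesonConst_ne_top hp)

/-- On a finite family the averages are at most twice the principal levels, so the `p`-th power of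
their supremum is at most `2^p ∑ m(F)^p 1_F`, which the Carleson embedding integrates. Monotone
convergence removes finiteness. -/
theorem lintegral_maximalFn_rpow_le (σ : Measure (Fin n → ℝ)) [IsLocallyFiniteMeasure σ]
    {p : ℝ} (hp : 1 < p) {f : (Fin n → ℝ) → ℝ≥0∞} (hf : Measurable f)
    (hfin : ∫⁻ x, f x ^ p ∂σ ≠ ∞) :
    ∫⁻ x, maximalFn σ f x ^ p ∂σ ≤ maximalConst p * ∫⁻ x, f x ^ p ∂σ := by
  classical
  have hp0 : 0 < p := by linarith
  set g : Finset (DyadicCube n) → (Fin n → ℝ) → ℝ≥0∞ := fun S x =>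
    S.sup fun Q => Q.1.indicator (fun _ => average σ f Q ^ p) x with hg
  have hgm : ∀ S, Measurable (g S) := fun S => by
    simp only [hg, Finset.sup_eq_iSup]
    exact Measurable.iSup fun Q => Measurable.iSup fun _ =>
      measurable_const.indicator Q.measurableSet
  have hpt : ∀ x, maximalFn σ f x ^ p ≤ ⨆ S, g S x := by
    intro x
    rw [maximalFn, ← ENNReal.le_rpow_inv_iff hp0]
    refine iSup_le fun Q => ?_
    rw [ENNReal.le_rpow_inv_iff hp0]
    refine le_trans ?_ (le_iSup _ {Q})
    by_cases hx : x ∈ Q.1 <;> simp [hg, hx, hp0]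
  have hdir : Directed (· ≤ ·) g := by
    intro S T
    refine ⟨S ∪ T, fun x => ?_, fun x => ?_⟩
    · exact Finset.sup_mono Finset.subset_union_left
    · exact Finset.sup_mono Finset.subset_union_right
  refine (lintegral_mono hpt).trans ?_
  rw [lintegral_iSup_directed (fun S => (hgm S).aemeasurable) hdir]
  refine iSup_le fun S => ?_
  obtain ⟨π, m, h1, -, h3⟩ := exists_principal_carleson σ hp hf hfin
    (S.filter fun Q => ∫⁻ x in Q.1, f x ∂σ ≠ 0) (by simp)
  set S' := S.filter fun Q => ∫⁻ x in Q.1, f x ∂σ ≠ 0 with hS'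
  have hle : ∀ x, g S x ≤ 2 ^ p * ∑ F ∈ S'.image π, F.1.indicator (fun _ => m F ^ p) x := by
    intro x
    refine Finset.sup_le fun Q hQ => ?_
    by_cases hx : x ∈ Q.1
    · rw [Set.indicator_of_mem hx]
      by_cases h0 : ∫⁻ x in Q.1, f x ∂σ = 0
      · simp [average, h0, hp0]
      have hQ' : Q ∈ S' := Finset.mem_filter.2 ⟨hQ, h0⟩
      calc average σ f Q ^ p ≤ (2 * m (π Q)) ^ p := by gcongr; exact (h1 Q hQ').2.2
        _ = 2 ^ p * (π Q).1.indicator (fun _ => m (π Q) ^ p) x := by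
          rw [ENNReal.mul_rpow_of_nonneg _ _ hp0.le, Set.indicator_of_mem ((h1 Q hQ').2.1 hx)]
        _ ≤ _ := by
          gcongr
          exact Finset.single_le_sum (f := fun F : DyadicCube n =>
            F.1.indicator (fun _ => m F ^ p) x) (fun _ _ => bot_le) (Finset.mem_image_of_mem π hQ')
    · simp [hx]
  have hmeas : ∀ F : DyadicCube n, Measurable (F.1.indicator fun _ => m F ^ p) := fun F =>
    measurable_const.indicator F.measurableSet
  refine (lintegral_mono hle).trans ?_
  rw [lintegral_const_mul _ (Finset.measurable_fun_sum _ fun F _ => hmeas F),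
    lintegral_finsetSum _ fun F _ => hmeas F, maximalConst, mul_assoc]
  simp only [lintegral_indicator_const, DyadicCube.measurableSet]
  gcongr
  refine h3 _ fun F hF => ?_
  simpa using hF

end Maximal

/-! ### From bilinear embeddings to testing and Wolff potential bounds -/

section Necessity

variable {n : ℕ}

theorem measurable_localSum (a : DyadicCube n → ℝ≥0∞) (Q : DyadicCube n) :
    Measurable (localSum a Q) :=
  Measurable.tsum fun R => measurable_const.indicator R.1.measurableSet

theorem setLIntegral_localSum (a : DyadicCube n → ℝ≥0∞) (μ : Measure (Fin n → ℝ))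
    (Q : DyadicCube n) :
    ∫⁻ x in Q.1, localSum a Q x ∂μ = ∑' R : {R : DyadicCube n // R.1 ⊆ Q.1}, a R.1 * μ R.1.1 := by
  unfold localSum
  rw [lintegral_tsum fun R => (measurable_const.indicator R.1.measurableSet).aemeasurable]
  refine tsum_congr fun R => ?_
  rw [lintegral_indicator_const R.1.measurableSet, Measure.restrict_apply R.1.measurableSet,
    Set.inter_eq_self_of_subset_left R.2]

theorem setLIntegral_kernelBar (L : DyadicCube n → ℝ≥0∞) (μ ν : Measure (Fin n → ℝ))
    {Q : DyadicCube n} (hQ : ν Q.1 ≠ 0) :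
    ∫⁻ x in Q.1, kernelBar L ν Q x ∂μ
      = (ν Q.1)⁻¹ * ∑' R : {R : DyadicCube n // R.1 ⊆ Q.1}, L R.1 * ν R.1.1 * μ R.1.1 := by
  simp only [kernelBar, hQ, if_false]
  rw [lintegral_const_mul _ (measurable_localSum _ _), setLIntegral_localSum]

theorem measurable_wolff (p : ℝ) (L : DyadicCube n → ℝ≥0∞) (μ ν : Measure (Fin n → ℝ)) :
    Measurable (wolff p L μ ν) :=
  Measurable.tsum fun R => measurable_const.indicator R.measurableSet

/-- The bilinear embedding inequality with constant `A`, for nonnegative functions. -/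
def BilinearEmbedding (p q : ℝ) (L : DyadicCube n → ℝ≥0∞) (μ ν : Measure (Fin n → ℝ))
    (A : ℝ≥0∞) : Prop :=
  ∀ f g : (Fin n → ℝ) → ℝ≥0∞, Measurable f → Measurable g →
    ∫⁻ x, f x ^ p ∂μ ≠ ∞ → ∫⁻ x, g x ^ q ∂ν ≠ ∞ →
      ∑' Q : DyadicCube n, L Q * (∫⁻ x in Q.1, f x ∂μ) * ∫⁻ x in Q.1, g x ∂ν
        ≤ A * (∫⁻ x, f x ^ p ∂μ) ^ (1 / p) * (∫⁻ x, g x ^ q ∂ν) ^ (1 / q)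

theorem measurable_tsum_indicator (a : DyadicCube n → ℝ≥0∞) :
    Measurable fun x => ∑' Q : DyadicCube n, Q.1.indicator (fun _ => a Q) x :=
  Measurable.tsum fun R => measurable_const.indicator R.measurableSet

theorem lintegral_tsum_indicator_mul (a : DyadicCube n → ℝ≥0∞) (ν : Measure (Fin n → ℝ))
    {g : (Fin n → ℝ) → ℝ≥0∞} (hg : Measurable g) :
    ∫⁻ x, (∑' Q : DyadicCube n, Q.1.indicator (fun _ => a Q) x) * g x ∂ν
      = ∑' Q : DyadicCube n, a Q * ∫⁻ x in Q.1, g x ∂ν := by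
  simp_rw [← ENNReal.tsum_mul_right]
  rw [lintegral_tsum (f := fun (Q : DyadicCube n) x => Q.1.indicator (fun _ => a Q) x * g x)
    fun Q => ((measurable_const.indicator Q.measurableSet).mul hg).aemeasurable]
  refine tsum_congr fun Q => ?_
  rw [← lintegral_const_mul _ hg, ← lintegral_indicator Q.measurableSet]
  refine lintegral_congr fun x => ?_
  by_cases hx : x ∈ Q.1 <;> simp [hx]

/-- With `f` frozen, the embedding bounds the pairing of this sum with every `g`, and the converse
of Hölder's inequality applies. -/
theorem BilinearEmbedding.lintegral_rpow_le {p q s : ℝ} (hqs : q.HolderConjugate s)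
    {L : DyadicCube n → ℝ≥0∞} {μ ν : Measure (Fin n → ℝ)} [IsLocallyFiniteMeasure ν] {A : ℝ≥0∞}
    (h : BilinearEmbedding p q L μ ν A) {f : (Fin n → ℝ) → ℝ≥0∞} (hf : Measurable f)
    (hfin : ∫⁻ x, f x ^ p ∂μ ≠ ∞) :
    ∫⁻ x, (∑' Q : DyadicCube n, Q.1.indicator (fun _ => L Q * ∫⁻ y in Q.1, f y ∂μ) x) ^ s ∂ν
      ≤ (A * (∫⁻ x, f x ^ p ∂μ) ^ (1 / p)) ^ s := by
  refine lintegral_rpow_le_of_forall_lintegral_mul_le hqs fun g hg hgfin => ?_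
  rw [lintegral_tsum_indicator_mul _ _ hg]
  exact h f g hf hg hfin hgfin

/-- Testing a localized kernel on the characteristic function of a cube. -/
theorem BilinearEmbedding.lintegral_localSum_le {p q s : ℝ} (hp : 0 < p)
    (hqs : q.HolderConjugate s) {L : DyadicCube n → ℝ≥0∞} {μ ν : Measure (Fin n → ℝ)}
    [IsLocallyFiniteMeasure μ] [IsLocallyFiniteMeasure ν] {A : ℝ≥0∞}
    (h : BilinearEmbedding p q L μ ν A) (Q : DyadicCube n) :
    (∫⁻ x in Q.1, localSum (fun R => L R * μ R.1) Q x ^ s ∂ν) ^ (1 / s)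
      ≤ A * μ Q.1 ^ (1 / p) := by
  have hs := hqs.symm.pos
  have e : ∀ x, (Q.1.indicator (fun _ => (1 : ℝ≥0∞)) x) ^ p
      = Q.1.indicator (fun _ => (1 : ℝ≥0∞)) x := fun x => by
    by_cases hx : x ∈ Q.1 <;> simp [hx, hp]
  have hI : ∫⁻ x, (Q.1.indicator (fun _ => (1 : ℝ≥0∞)) x) ^ p ∂μ = μ Q.1 := by
    simp only [e]
    rw [lintegral_indicator_const Q.measurableSet, one_mul]
  have := h.lintegral_rpow_le hqs (f := Q.1.indicator fun _ => 1)
    (measurable_const.indicator Q.measurableSet) (by rw [hI]; exact Q.measure_ne_top μ)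
  rw [hI] at this
  rw [one_div, ENNReal.rpow_inv_le_iff hs]
  refine le_trans ((setLIntegral_le_lintegral _ _).trans (lintegral_mono fun x => ?_)) this
  refine ENNReal.rpow_le_rpow ?_ hs.le
  unfold localSum
  refine le_trans (ENNReal.tsum_le_tsum fun R => ?_) (ENNReal.tsum_comp_le_tsum_of_injective
    (f := ((↑) : {R : DyadicCube n // R.1 ⊆ Q.1} → DyadicCube n)) Subtype.val_injective _)
  refine Set.indicator_le_indicator (le_of_eq ?_)
  rw [lintegral_indicator_const Q.measurableSet, one_mul, Measure.restrict_apply Q.measurableSet,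
    Set.inter_eq_self_of_subset_right R.2]

/-- The constant in the Wolff potential bound derived from a bilinear embedding. -/
def wolffConst (s t : ℝ) : ℝ≥0∞ :=
  maximalConst s ^ (1 - 1 / s) * maximalConst t ^ (1 / t)

theorem wolffConst_ne_top {s t : ℝ} (hs : 1 < s) (ht : 1 < t) : wolffConst s t ≠ ∞ :=
  ENNReal.mul_ne_top
    (ENNReal.rpow_ne_top_of_nonneg (sub_nonneg.2 ((div_le_one (by linarith)).2 hs.le))
      (maximalConst_ne_top hs))
    (ENNReal.rpow_ne_top_of_nonneg (by positivity) (maximalConst_ne_top ht))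

/-- The averages of `G` are dominated by its maximal function, so the sum is at most `∫ G (M
G)^{s-1}`; Hölder and the maximal theorem finish. -/
theorem tsum_mul_average_rpow_le {s : ℝ} (hs : 1 < s) (ν : Measure (Fin n → ℝ))
    [IsLocallyFiniteMeasure ν] (a : DyadicCube n → ℝ≥0∞) {G : (Fin n → ℝ) → ℝ≥0∞}
    (hG : G = fun x => ∑' Q : DyadicCube n, Q.1.indicator (fun _ => a Q) x)
    (hfin : ∫⁻ x, G x ^ s ∂ν ≠ ∞) :
    ∑' Q : DyadicCube n, a Q * (ν Q.1 * average ν G Q ^ (s - 1))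
      ≤ maximalConst s ^ (1 - 1 / s) * ∫⁻ x, G x ^ s ∂ν := by
  have hs0 : 0 < s := by linarith
  have hGm : Measurable G := hG ▸ measurable_tsum_indicator a
  have hMm := measurable_maximalFn ν G
  have hs1 : 0 ≤ 1 - 1 / s := sub_nonneg.2 ((div_le_one hs0).2 hs.le)
  calc _ ≤ ∑' Q : DyadicCube n, a Q * ∫⁻ x in Q.1, maximalFn ν G x ^ (s - 1) ∂ν := by
        refine ENNReal.tsum_le_tsum fun Q => mul_le_mul_right ?_ _
        rw [mul_comm, ← setLIntegral_const]
        refine setLIntegral_mono (hMm.pow_const _) fun x hx => ?_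
        exact ENNReal.rpow_le_rpow (average_le_maximalFn ν G hx) (by linarith)
    _ = ∫⁻ x, G x * maximalFn ν G x ^ (s - 1) ∂ν := by
        rw [hG, ← lintegral_tsum_indicator_mul _ _ ((measurable_maximalFn ν _).pow_const _)]
    _ = ∫⁻ x, (G x ^ s) ^ (1 / s) * (maximalFn ν G x ^ s) ^ (1 - 1 / s) ∂ν := by
        refine lintegral_congr fun x => ?_
        rw [← ENNReal.rpow_mul, ← ENNReal.rpow_mul, mul_one_div_cancel hs0.ne', ENNReal.rpow_one]
        congr 2
        field_simp
    _ ≤ (∫⁻ x, G x ^ s ∂ν) ^ (1 / s) * (∫⁻ x, maximalFn ν G x ^ s ∂ν) ^ (1 - 1 / s) :=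
        lintegral_rpow_mul_rpow_le (hGm.pow_const _) (hMm.pow_const _) (by positivity) hs1
          (by ring)
    _ ≤ (∫⁻ x, G x ^ s ∂ν) ^ (1 / s) * (maximalConst s * ∫⁻ x, G x ^ s ∂ν) ^ (1 - 1 / s) := by
        gcongr
        exact lintegral_maximalFn_rpow_le ν hs hGm hfin
    _ = maximalConst s ^ (1 - 1 / s) * ((∫⁻ x, G x ^ s ∂ν) ^ (1 / s)
          * (∫⁻ x, G x ^ s ∂ν) ^ (1 - 1 / s)) := by
        rw [ENNReal.mul_rpow_of_nonneg _ _ hs1]; ring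
    _ = _ := by
        rw [← ENNReal.rpow_add_of_nonneg _ _ (by positivity) hs1]
        simp

/-- A bilinear embedding bounds the pairing of the Wolff potential with a function. -/
theorem BilinearEmbedding.lintegral_wolff_mul_le {p q s t : ℝ} 
    (hqs : q.HolderConjugate s) (ht : 1 < t) (hpt : p = s * t) {L : DyadicCube n → ℝ≥0∞}
    {μ ν : Measure (Fin n → ℝ)} [IsLocallyFiniteMeasure μ] [IsLocallyFiniteMeasure ν] {A : ℝ≥0∞}
    (hA : A ≠ ∞) (H : BilinearEmbedding p q L μ ν A) {h : (Fin n → ℝ) → ℝ≥0∞} (hh : Measurable h)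
    (hfin : ∫⁻ x, h x ^ t ∂μ ≠ ∞) :
    ∫⁻ x, wolff s L ν μ x * h x ∂μ
      ≤ wolffConst s t * A ^ s * (∫⁻ x, h x ^ t ∂μ) ^ (1 / t) := by
  have hs : 1 < s := hqs.symm.lt
  have hs0 : 0 < s := by linarith
  -- On each `Q` this `f` is at least the `1/s` power of the mean of `h`, while `p = s t` makes `∫
  -- f^p = ∫ (M h)^t`.
  set f : (Fin n → ℝ) → ℝ≥0∞ := fun x => maximalFn μ h x ^ (1 / s) with hf
  have hfm : Measurable f := (measurable_maximalFn μ h).pow_const _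
  have hfp : ∫⁻ x, f x ^ p ∂μ = ∫⁻ x, maximalFn μ h x ^ t ∂μ := by
    refine lintegral_congr fun x => ?_
    rw [hf, ← ENNReal.rpow_mul, hpt]
    congr 1
    field_simp
  have hMh := lintegral_maximalFn_rpow_le μ ht hh hfin
  have hMfin : ∫⁻ x, maximalFn μ h x ^ t ∂μ ≠ ∞ :=
    ne_top_of_le_ne_top (ENNReal.mul_ne_top (maximalConst_ne_top ht) hfin) hMh
  set a : DyadicCube n → ℝ≥0∞ := fun Q => L Q * ∫⁻ y in Q.1, f y ∂μ with ha
  set G : (Fin n → ℝ) → ℝ≥0∞ := fun x => ∑' Q : DyadicCube n, Q.1.indicator (fun _ => a Q) x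
    with hG
  have hGs : ∫⁻ x, G x ^ s ∂ν ≤ A ^ s * (∫⁻ x, maximalFn μ h x ^ t ∂μ) ^ (1 / t) := by
    have := H.lintegral_rpow_le hqs hfm (by rwa [hfp])
    rw [hfp, ENNReal.mul_rpow_of_nonneg _ _ hs0.le, ← ENNReal.rpow_mul,
      show 1 / p * s = 1 / t by rw [hpt]; field_simp] at this
    exact this
  have hGfin : ∫⁻ x, G x ^ s ∂ν ≠ ∞ := ne_top_of_le_ne_top
    (ENNReal.mul_ne_top (ENNReal.rpow_ne_top_of_nonneg hs0.le hA)
      (ENNReal.rpow_ne_top_of_nonneg (by positivity) hMfin)) hGs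
  -- The mean `τ` of `h` factors as `τ^{1/s} (τ^{1/s})^{s-1}`. The first factor turns `L(Q) μ(Q)`
  -- into at most `a(Q)`, the second turns `(∫_Q K̄)^{s-1}` into at most a power of the mean of `G`.
  have hterm : ∀ Q : DyadicCube n,
      L Q * ν Q.1 * (∫⁻ y in Q.1, kernelBar L ν Q y ∂μ) ^ (s - 1) * ∫⁻ x in Q.1, h x ∂μ
        ≤ a Q * (ν Q.1 * average ν G Q ^ (s - 1)) := by
    intro Q
    by_cases hν : ν Q.1 = 0
    · simp [hν]
    set τ := average μ h Q with hτ
    have hfτ : ∀ x ∈ Q.1, τ ^ (1 / s) ≤ f x := fun x hx =>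
      ENNReal.rpow_le_rpow (average_le_maximalFn μ h hx) (by positivity)
    have hint : ∀ R : DyadicCube n, R.1 ⊆ Q.1 → τ ^ (1 / s) * μ R.1 ≤ ∫⁻ x in R.1, f x ∂μ := by
      intro R hR
      rw [← setLIntegral_const]
      exact setLIntegral_mono hfm fun x hx => hfτ x (hR hx)
    have hGQ : τ ^ (1 / s) * ∫⁻ y in Q.1, kernelBar L ν Q y ∂μ ≤ average ν G Q := by
      rw [setLIntegral_kernelBar _ _ _ hν, average, mul_left_comm]
      gcongr
      calc τ ^ (1 / s) * ∑' R : {R : DyadicCube n // R.1 ⊆ Q.1}, L R.1 * ν R.1.1 * μ R.1.1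
          ≤ ∑' R : {R : DyadicCube n // R.1 ⊆ Q.1}, a R.1 * ν R.1.1 := by
            rw [← ENNReal.tsum_mul_left]
            refine ENNReal.tsum_le_tsum fun R => ?_
            calc τ ^ (1 / s) * (L R.1 * ν R.1.1 * μ R.1.1)
                = L R.1 * (τ ^ (1 / s) * μ R.1.1) * ν R.1.1 := by ring
              _ ≤ a R.1 * ν R.1.1 := by
                rw [ha]; dsimp only; gcongr; exact hint R.1 R.2
        _ = ∫⁻ x in Q.1, localSum a Q x ∂ν := (setLIntegral_localSum _ _ _).symm
        _ ≤ ∫⁻ x in Q.1, G x ∂ν := by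
            refine lintegral_mono fun x => ?_
            exact ENNReal.tsum_comp_le_tsum_of_injective
              (f := ((↑) : {R : DyadicCube n // R.1 ⊆ Q.1} → DyadicCube n))
              Subtype.val_injective _
    set b := ∫⁻ y in Q.1, kernelBar L ν Q y ∂μ with hb
    calc L Q * ν Q.1 * b ^ (s - 1) * ∫⁻ x in Q.1, h x ∂μ
        = L Q * ((τ ^ (1 / s) * μ Q.1)) * (ν Q.1 * (τ ^ (1 / s) * b) ^ (s - 1)) := by
          rw [← average_mul_measure, ← hτ, ENNReal.mul_rpow_of_nonneg _ _ (by linarith : 0 ≤ s - 1),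
            ← ENNReal.rpow_mul]
          have : τ = τ ^ (1 / s) * τ ^ (1 / s * (s - 1)) := by
            rw [← ENNReal.rpow_add_of_nonneg _ _ (by positivity)
              (mul_nonneg (by positivity) (by linarith))]
            rw [show 1 / s + 1 / s * (s - 1) = 1 by field_simp; ring, ENNReal.rpow_one]
          conv_lhs => rw [this]
          ring
      _ ≤ _ := by
          rw [ha]; dsimp only
          gcongr
          exact hint Q subset_rfl
  calc ∫⁻ x, wolff s L ν μ x * h x ∂μ
      = ∑' Q : DyadicCube n,
          L Q * ν Q.1 * (∫⁻ y in Q.1, kernelBar L ν Q y ∂μ) ^ (s - 1) * ∫⁻ x in Q.1, h x ∂μ :=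
        lintegral_tsum_indicator_mul _ _ hh
    _ ≤ ∑' Q : DyadicCube n, a Q * (ν Q.1 * average ν G Q ^ (s - 1)) :=
        ENNReal.tsum_le_tsum hterm
    _ ≤ maximalConst s ^ (1 - 1 / s) * ∫⁻ x, G x ^ s ∂ν :=
        tsum_mul_average_rpow_le hs ν a hG hGfin
    _ ≤ maximalConst s ^ (1 - 1 / s) *
          (A ^ s * (maximalConst t * ∫⁻ x, h x ^ t ∂μ) ^ (1 / t)) := by
        gcongr
        refine hGs.trans ?_
        gcongr
    _ = _ := by
        rw [ENNReal.mul_rpow_of_nonneg _ _ (by positivity : 0 ≤ 1 / t), wolffConst]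
        ring

/-- The discrete Wolff theorem, necessity. -/
theorem BilinearEmbedding.lintegral_wolff_rpow_le {p q s r : ℝ} (hp : 0 < p) (hr : 0 < r)
    (hqs : q.HolderConjugate s) (hpr : 1 / r + 1 / p + 1 / q = 1) {L : DyadicCube n → ℝ≥0∞}
    {μ ν : Measure (Fin n → ℝ)} [IsLocallyFiniteMeasure μ] [IsLocallyFiniteMeasure ν] {A : ℝ≥0∞}
    (hA : A ≠ ∞) (H : BilinearEmbedding p q L μ ν A) :
    (∫⁻ x, (wolff s L ν μ x ^ (1 / s)) ^ r ∂μ) ^ (1 / r)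
      ≤ wolffConst s (p / s) ^ (1 / s) * A := by
  have hs0 : 0 < s := hqs.symm.pos
  have hs : 1 / s = 1 / p + 1 / r := by
    have := hqs.inv_add_inv_eq_one
    simp only [one_div] at hpr ⊢
    linarith
  have hsp : s < p := by
    have : 1 / p < 1 / s := by rw [hs]; have : 0 < 1 / r := by positivity
                               linarith
    exact (one_div_lt_one_div hp hs0).1 this
  have ht : 1 < p / s := (one_lt_div hs0).2 hsp
  -- The relation `1/s = 1/p + 1/r` says `s/p + s/r = 1`, so the `L^{r/s}` norm of the potential is
  -- dual to `L^{p/s}`.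
  have hconj : (p / s).HolderConjugate (r / s) := by
    rw [Real.holderConjugate_iff]
    refine ⟨ht, ?_⟩
    field_simp at hs ⊢
    linarith
  have key := lintegral_rpow_le_of_forall_lintegral_mul_le hconj (μ := μ) (F := wolff s L ν μ)
    (A := wolffConst s (p / s) * A ^ s) fun h hh hfin =>
      H.lintegral_wolff_mul_le hqs ht (by field_simp) hA hh hfin
  rw [one_div r, ENNReal.rpow_inv_le_iff hr]
  calc ∫⁻ x, (wolff s L ν μ x ^ (1 / s)) ^ r ∂μ = ∫⁻ x, wolff s L ν μ x ^ (r / s) ∂μ := by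
        refine lintegral_congr fun x => ?_
        rw [← ENNReal.rpow_mul]; congr 1; ring
    _ ≤ _ := key
    _ = _ := by
        rw [ENNReal.mul_rpow_of_nonneg _ _ (by positivity : 0 ≤ r / s),
          ENNReal.mul_rpow_of_nonneg _ _ hr.le, ← ENNReal.rpow_mul, ← ENNReal.rpow_mul]
        congr 2
        · ring
        · field_simp

end Necessity

/-! ### Stopped bilinear forms -/

section Sufficiency

variable {n : ℕ}

open Classical in
theorem sum_measure_le_of_maximal (ν : Measure (Fin n → ℝ)) (T : Finset (DyadicCube n))
    (hT : ∀ Q ∈ T, ∀ R ∈ T, Q.1 ⊆ R.1 → Q = R) (G : DyadicCube n) (hG : ∀ Q ∈ T, Q.1 ⊆ G.1) :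
    ∑ Q ∈ T, ν Q.1 ≤ ν G.1 := by
  rw [← measure_biUnion_finset _ fun Q _ => Q.measurableSet]
  · exact measure_mono (Set.iUnion₂_subset hG)
  · intro Q hQ R hR hne
    rw [Function.onFun, Set.disjoint_iff_inter_eq_empty, ← Set.not_nonempty_iff_eq_empty]
    intro h
    rcases Q.subset_or_subset R h with h | h
    · exact hne (hT Q hQ R hR h)
    · exact hne (hT R hR Q hQ h).symm

open Classical in
/-- If `∑_{R ⊆ Q} b(R) ≤ ν(Q) a(Q)` in a finite family of cubes below `G`, then
`∑ b ≤ 2 ν(G)^{1-1/s} (∑ b a^{s-1})^{1/s}`. -/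
theorem sum_le_rpow_mul_rpow {s : ℝ} (hs : 1 < s) (ν : Measure (Fin n → ℝ))
    [IsLocallyFiniteMeasure ν] (D : Finset (DyadicCube n)) (G : DyadicCube n)
    (hG : ∀ Q ∈ D, Q.1 ⊆ G.1) (a b : DyadicCube n → ℝ≥0∞) (hb : ∀ Q ∈ D, b Q ≠ ∞)
    (h : ∀ Q ∈ D, ∑ R ∈ D with R.1 ⊆ Q.1, b R ≤ ν Q.1 * a Q) :
    ∑ Q ∈ D, b Q ≤ 2 * ν G.1 ^ (1 - 1 / s) * (∑ Q ∈ D, b Q * a Q ^ (s - 1)) ^ (1 / s) := by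
  have hs0 : 0 < s := by linarith
  have hs1 : 0 ≤ 1 - 1 / s := sub_nonneg.2 ((div_le_one hs0).2 hs.le)
  set T := ∑ Q ∈ D, b Q with hT
  have hTt : T ≠ ∞ := ENNReal.sum_ne_top.2 hb
  rcases eq_or_ne (ν G.1) 0 with hν | hν
  · have : T = 0 := Finset.sum_eq_zero fun Q hQ => by
      have h1 := h Q hQ
      rw [measure_mono_null (hG Q hQ) hν, zero_mul] at h1
      refine le_antisymm (le_trans ?_ h1) bot_le
      exact Finset.single_le_sum (f := b) (fun _ _ => bot_le) (by simp [hQ])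
    rw [this]; exact bot_le
  have hνt := G.measure_ne_top ν
  -- The threshold is half the mean `T / ν(G)`: the cubes with `a < θ` carry at most `T / 2`, by
  -- disjointness of the maximal ones, so those with `a ≥ θ` carry at least as much.
  set θ := T / (2 * ν G.1) with hθ
  have hθν : 2 * ν G.1 * θ = T := ENNReal.mul_div_cancel (by simp [hν]) (by finiteness)
  set bad := D.filter fun Q => a Q < θ with hbad
  have hbadsum : ∑ Q ∈ bad, b Q ≤ ν G.1 * θ := by
    have htop : ∀ Q ∈ bad, ∃ P, Q.1 ⊆ P.1 ∧ P ∈ bad.filter fun P => ∀ R ∈ bad, P.1 ⊆ R.1 → P = R := by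
      intro Q hQ
      obtain ⟨P, hQP, hP⟩ := bad.exists_le_maximal hQ
      refine ⟨P, hQP, Finset.mem_filter.2 ⟨hP.1, fun R hR hPR => ?_⟩⟩
      exact Subtype.ext (Set.Subset.antisymm hPR (hP.2 hR hPR))
    choose! P hQP hP using htop
    set M := bad.filter fun P => ∀ R ∈ bad, P.1 ⊆ R.1 → P = R with hM
    calc ∑ Q ∈ bad, b Q = ∑ F ∈ M, ∑ Q ∈ bad with P Q = F, b Q :=
          (Finset.sum_fiberwise_of_maps_to hP _).symm
      _ ≤ ∑ F ∈ M, ν F.1 * θ := by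
          refine Finset.sum_le_sum fun F hF => ?_
          have hF' := (Finset.mem_filter.1 (Finset.mem_filter.1 hF).1)
          calc ∑ Q ∈ bad with P Q = F, b Q ≤ ∑ R ∈ D with R.1 ⊆ F.1, b R := by
                refine Finset.sum_le_sum_of_subset fun Q hQ => ?_
                rw [Finset.mem_filter] at hQ ⊢
                exact ⟨(Finset.mem_filter.1 hQ.1).1, hQ.2 ▸ hQP Q hQ.1⟩
            _ ≤ ν F.1 * a F := h F hF'.1
            _ ≤ ν F.1 * θ := by gcongr; exact hF'.2.le
      _ ≤ ν G.1 * θ := by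
          rw [← Finset.sum_mul]
          gcongr
          refine sum_measure_le_of_maximal ν M (fun Q hQ R hR hQR => ?_) G fun Q hQ => ?_
          · exact (Finset.mem_filter.1 hQ).2 R (Finset.mem_filter.1 hR).1 hQR
          · exact hG Q (Finset.mem_filter.1 (Finset.mem_filter.1 hQ).1).1
  have hνθ : ν G.1 * θ + ν G.1 * θ = T := by rw [← hθν]; ring
  have hνθt : ν G.1 * θ ≠ ∞ := ne_top_of_le_ne_top hTt (hνθ ▸ le_self_add)
  have hgood : ν G.1 * θ ≤ ∑ Q ∈ D with ¬ a Q < θ, b Q := by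
    refine (ENNReal.add_le_add_iff_left hνθt).1 ?_
    rw [hνθ, hT, ← Finset.sum_filter_add_sum_filter_not D (fun Q => a Q < θ)]
    gcongr
  have hΛ : ν G.1 * θ * θ ^ (s - 1) ≤ ∑ Q ∈ D, b Q * a Q ^ (s - 1) := by
    calc _ ≤ (∑ Q ∈ D with ¬ a Q < θ, b Q) * θ ^ (s - 1) := by gcongr
      _ = ∑ Q ∈ D with ¬ a Q < θ, b Q * θ ^ (s - 1) := Finset.sum_mul _ _ _
      _ ≤ ∑ Q ∈ D with ¬ a Q < θ, b Q * a Q ^ (s - 1) := by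
          refine Finset.sum_le_sum fun Q hQ => ?_
          have := not_lt.1 (Finset.mem_filter.1 hQ).2
          have : 0 ≤ s - 1 := by linarith
          gcongr
      _ ≤ _ := Finset.sum_le_sum_of_subset (Finset.filter_subset _ _)
  have e : ν G.1 * θ * θ ^ (s - 1) = ν G.1 * θ ^ s := by
    rw [mul_assoc]
    congr 1
    nth_rw 1 [← ENNReal.rpow_one θ]
    rw [← ENNReal.rpow_add_of_nonneg _ _ zero_le_one (by linarith)]
    congr 1; ring
  rw [e] at hΛ
  calc T = 2 * (ν G.1 ^ (1 - 1 / s) * ν G.1 ^ (1 / s)) * (θ ^ s) ^ (1 / s) := by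
        rw [← ENNReal.rpow_add_of_nonneg _ _ hs1 (by positivity), ← ENNReal.rpow_mul,
          mul_one_div_cancel hs0.ne', sub_add_cancel, ENNReal.rpow_one, ENNReal.rpow_one, hθν]
    _ = 2 * ν G.1 ^ (1 - 1 / s) * (ν G.1 * θ ^ s) ^ (1 / s) := by
        rw [ENNReal.mul_rpow_of_nonneg _ _ (by positivity : 0 ≤ 1 / s)]; ring
    _ ≤ _ := by gcongr

theorem sum_indicator_le_localSum (a : DyadicCube n → ℝ≥0∞) (F : DyadicCube n)
    (U : Finset (DyadicCube n)) (hU : ∀ Q ∈ U, Q.1 ⊆ F.1) (x : Fin n → ℝ) :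
    ∑ Q ∈ U, Q.1.indicator (fun _ => a Q) x ≤ localSum a F x := by
  classical
  unfold localSum
  rw [← Finset.sum_subtype_of_mem (p := fun R : DyadicCube n => R.1 ⊆ F.1)
    (fun Q : DyadicCube n => Q.1.indicator (fun _ => a Q) x) hU]
  exact ENNReal.sum_le_tsum _

/-- This supplies the hypothesis of `sum_le_rpow_mul_rpow`. The value `0` of `kernelBar` on null
cubes is harmless, as every term on the left then vanishes. -/
theorem sum_mul_le_setLIntegral_kernelBar (L : DyadicCube n → ℝ≥0∞) (μ ν : Measure (Fin n → ℝ))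
    [IsLocallyFiniteMeasure ν] (U : Finset (DyadicCube n)) (Q : DyadicCube n)
    (hU : ∀ R ∈ U, R.1 ⊆ Q.1) :
    ∑ R ∈ U, L R * μ R.1 * ν R.1 ≤ ν Q.1 * ∫⁻ x in Q.1, kernelBar L ν Q x ∂μ := by
  classical
  by_cases hν : ν Q.1 = 0
  · rw [hν, zero_mul]
    refine le_of_eq (Finset.sum_eq_zero fun R hR => ?_)
    rw [measure_mono_null (hU R hR) hν, mul_zero]
  rw [setLIntegral_kernelBar _ _ _ hν, ← mul_assoc,
    ENNReal.mul_inv_cancel hν (Q.measure_ne_top ν), one_mul,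
    ← Finset.sum_subtype_of_mem (p := fun R : DyadicCube n => R.1 ⊆ Q.1)
      (fun R : DyadicCube n => L R * μ R.1 * ν R.1) hU]
  refine le_trans (Finset.sum_le_sum fun R _ => ?_) (ENNReal.sum_le_tsum _)
  rw [mul_right_comm]

theorem mul_rpow_one_div {p : ℝ} (hp : 0 < p) (x y : ℝ≥0∞) :
    (x ^ p * y) ^ (1 / p) = x * y ^ (1 / p) := by
  rw [ENNReal.mul_rpow_of_nonneg _ _ (by positivity), ← ENNReal.rpow_mul,
    mul_one_div_cancel hp.ne', ENNReal.rpow_one]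

/-- It replaces a level depending on the cube by a function of the point, which can be pulled out of
sums over cubes containing that point. -/
theorem le_sum_indicator_rpow {p : ℝ} (hp : 0 < p) (m : DyadicCube n → ℝ≥0∞)
    {T : Finset (DyadicCube n)} {F : DyadicCube n} (hF : F ∈ T) {x : Fin n → ℝ} (hx : x ∈ F.1) :
    m F ≤ (∑ F ∈ T, F.1.indicator (fun _ => m F ^ p) x) ^ (1 / p) := by
  rw [one_div, ENNReal.le_rpow_inv_iff hp]
  refine le_trans (by simp [hx]) (Finset.single_le_sum (f := fun F : DyadicCube n =>
    F.1.indicator (fun _ => m F ^ p) x) (fun _ _ => bot_le) hF)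

theorem lintegral_sum_indicator (μ : Measure (Fin n → ℝ)) (m : DyadicCube n → ℝ≥0∞)
    (T : Finset (DyadicCube n)) :
    ∫⁻ x, ∑ F ∈ T, F.1.indicator (fun _ => m F) x ∂μ = ∑ F ∈ T, m F * μ F.1 := by
  rw [lintegral_finsetSum _ fun F _ => measurable_const.indicator F.measurableSet]
  simp [DyadicCube.measurableSet]

theorem measurable_sum_indicator (m : DyadicCube n → ℝ≥0∞) (T : Finset (DyadicCube n)) :
    Measurable fun x => ∑ F ∈ T, F.1.indicator (fun _ => m F) x :=
  Finset.measurable_fun_sum _ fun F _ => measurable_const.indicator F.measurableSet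

open Classical in
/-- The stopped bilinear form is controlled by the Sawyer testing condition. -/
theorem sum_le_of_sawyer {p q s : ℝ} (hp : 0 < p) (hqs : q.HolderConjugate s)
    (hpq : 1 ≤ 1 / p + 1 / q) {L : DyadicCube n → ℝ≥0∞} {μ ν : Measure (Fin n → ℝ)}
    {A : ℝ≥0∞} (U : Finset (DyadicCube n)) (α β : DyadicCube n → DyadicCube n)
    (hα : ∀ Q ∈ U, Q.1 ⊆ (α Q).1) (hβ : ∀ Q ∈ U, Q.1 ⊆ (β Q).1)
    (hαβ : ∀ Q ∈ U, α (β Q) = α Q) (m k : DyadicCube n → ℝ≥0∞)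
    (htest : ∀ F ∈ U.image α, (∫⁻ x in F.1, localSum (fun R => L R * μ R.1) F x ^ s ∂ν) ^ (1 / s)
      ≤ A * μ F.1 ^ (1 / p)) :
    ∑ Q ∈ U, L Q * μ Q.1 * ν Q.1 * (m (α Q) * k (β Q))
      ≤ A * (∑ F ∈ U.image α, m F ^ p * μ F.1) ^ (1 / p)
          * (∑ F ∈ U.image β, k F ^ q * ν F.1) ^ (1 / q) := by
  have hs := hqs.symm.pos
  have hq := hqs.pos
  have hsq : 1 / s + 1 / q = 1 := by simpa [add_comm] using hqs.inv_add_inv_eq_one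
  -- By `hαβ` every cube `β Q` has the same `α` as `Q`, so the energy of `k` is distributed over the
  -- cubes `F` without repetition.
  set z : DyadicCube n → ℝ≥0∞ := fun F => ∑ G ∈ U.image β with α G = F, k G ^ q * ν G.1 with hz
  have hinner : ∀ F ∈ U.image α, ∑ Q ∈ U with α Q = F, L Q * μ Q.1 * ν Q.1 * k (β Q)
      ≤ A * μ F.1 ^ (1 / p) * z F ^ (1 / q) := by
    intro F hF
    set V := U.filter fun Q => α Q = F with hV
    have hVF : ∀ Q ∈ V, Q.1 ⊆ F.1 := fun Q hQ => by
      obtain ⟨h1, h2⟩ := Finset.mem_filter.1 hQ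
      exact h2 ▸ hα Q h1
    set φ : (Fin n → ℝ) → ℝ≥0∞ := fun x =>
      ∑ G ∈ U.image β with α G = F, G.1.indicator (fun _ => k G ^ q) x with hφ
    set l := localSum (fun R => L R * μ R.1) F with hl
    calc ∑ Q ∈ V, L Q * μ Q.1 * ν Q.1 * k (β Q)
        = ∫⁻ x in F.1, ∑ Q ∈ V, Q.1.indicator (fun _ => L Q * μ Q.1 * k (β Q)) x ∂ν := by
          rw [lintegral_sum_indicator]
          refine Finset.sum_congr rfl fun Q hQ => ?_
          rw [Measure.restrict_apply Q.measurableSet,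
            Set.inter_eq_self_of_subset_left (hVF Q hQ)]
          ring
      -- On `Q` the level `k (β Q)` is at most `φ^{1/q}`, and what remains is the tested function.
      _ ≤ ∫⁻ x in F.1, (l x ^ s) ^ (1 / s) * φ x ^ (1 / q) ∂ν := by
          refine lintegral_mono fun x => ?_
          rw [← ENNReal.rpow_mul, mul_one_div_cancel hs.ne', ENNReal.rpow_one]
          refine le_trans ?_ (mul_le_mul_left (sum_indicator_le_localSum _ F V hVF x) _)
          rw [Finset.sum_mul]
          refine Finset.sum_le_sum fun Q hQ => ?_
          by_cases hx : x ∈ Q.1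
          · rw [Set.indicator_of_mem hx, Set.indicator_of_mem hx]
            gcongr
            obtain ⟨h1, h2⟩ := Finset.mem_filter.1 hQ
            have hmem : β Q ∈ (U.image β).filter fun G => α G = F :=
              Finset.mem_filter.2 ⟨Finset.mem_image_of_mem β h1, (hαβ Q h1).trans h2⟩
            exact le_sum_indicator_rpow hq k hmem (hβ Q h1 hx)
          · simp [hx]
      _ ≤ (∫⁻ x in F.1, l x ^ s ∂ν) ^ (1 / s) * (∫⁻ x in F.1, φ x ∂ν) ^ (1 / q) :=
          lintegral_rpow_mul_rpow_le ((measurable_localSum _ _).pow_const _)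
            (measurable_sum_indicator _ _) (by positivity) (by positivity) hsq
      _ ≤ _ := by
          gcongr
          · exact htest F hF
          · exact (setLIntegral_le_lintegral _ _).trans_eq (lintegral_sum_indicator _ _ _)
  calc ∑ Q ∈ U, L Q * μ Q.1 * ν Q.1 * (m (α Q) * k (β Q))
      = ∑ F ∈ U.image α, m F * ∑ Q ∈ U with α Q = F, L Q * μ Q.1 * ν Q.1 * k (β Q) := by
        rw [← Finset.sum_fiberwise_of_maps_to fun Q hQ => Finset.mem_image_of_mem α hQ]
        refine Finset.sum_congr rfl fun F _ => ?_
        rw [Finset.mul_sum]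
        refine Finset.sum_congr rfl fun Q hQ => ?_
        rw [(Finset.mem_filter.1 hQ).2]
        ring
    _ ≤ ∑ F ∈ U.image α, m F * (A * μ F.1 ^ (1 / p) * z F ^ (1 / q)) :=
        Finset.sum_le_sum fun F hF => mul_le_mul_right (hinner F hF) _
    _ = A * ∑ F ∈ U.image α, (m F ^ p * μ F.1) ^ (1 / p) * z F ^ (1 / q) := by
        rw [Finset.mul_sum]
        refine Finset.sum_congr rfl fun F _ => ?_
        rw [mul_rpow_one_div hp]
        ring
    _ ≤ A * ((∑ F ∈ U.image α, m F ^ p * μ F.1) ^ (1 / p)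
          * (∑ F ∈ U.image α, z F) ^ (1 / q)) := by
        gcongr
        exact sum_rpow_mul_rpow_le _ _ _ (by positivity) (by positivity) hpq
    _ = _ := by
        rw [hz, Finset.sum_fiberwise_of_maps_to, mul_assoc]
        intro G hG
        obtain ⟨Q, hQ, rfl⟩ := Finset.mem_image.1 hG
        rw [hαβ Q hQ]
        exact Finset.mem_image_of_mem α hQ

open Classical in
/-- The stopped bilinear form is controlled by the Wolff potential. -/
theorem sum_le_of_wolff {p q s r : ℝ} (hp : 0 < p) (hr : 0 < r) (hqs : q.HolderConjugate s)
    (hpq : 1 / r + 1 / p + 1 / q = 1) {L : DyadicCube n → ℝ≥0∞} {μ ν : Measure (Fin n → ℝ)}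
    [IsLocallyFiniteMeasure μ] [IsLocallyFiniteMeasure ν]
    {A : ℝ≥0∞} (U : Finset (DyadicCube n)) (hL : ∀ Q ∈ U, L Q ≠ ∞)
    (α β : DyadicCube n → DyadicCube n)
    (hα : ∀ Q ∈ U, Q.1 ⊆ (α Q).1) (hβ : ∀ Q ∈ U, Q.1 ⊆ (β Q).1)
    (hαβ : ∀ Q ∈ U, α (β Q) = α Q) (m k : DyadicCube n → ℝ≥0∞)
    (hW : (∫⁻ x, (wolff s L ν μ x ^ (1 / s)) ^ r ∂μ) ^ (1 / r) ≤ A) :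
    ∑ Q ∈ U, L Q * μ Q.1 * ν Q.1 * (m (α Q) * k (β Q))
      ≤ 2 * A * (∑ F ∈ U.image α, m F ^ p * μ F.1) ^ (1 / p)
          * (∑ F ∈ U.image β, k F ^ q * ν F.1) ^ (1 / q) := by
  have hs := hqs.symm.pos
  have hq := hqs.pos
  have hsq : 1 / q = 1 - 1 / s := by
    have := hqs.inv_add_inv_eq_one
    simp only [one_div]; linarith
  set a : DyadicCube n → ℝ≥0∞ := fun Q => ∫⁻ x in Q.1, kernelBar L ν Q x ∂μ with ha
  set Λ : DyadicCube n → ℝ≥0∞ := fun G =>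
    ∑ Q ∈ U with β Q = G, L Q * μ Q.1 * ν Q.1 * a Q ^ (s - 1) with hΛ
  set y := ∑ F ∈ U.image α, m F ^ p * μ F.1 with hy
  -- Here the fibres of `β` are frozen first: below `G` both levels are constant, so only the mass
  -- of the kernel matters.
  have hT : ∀ G ∈ U.image β, ∑ Q ∈ U with β Q = G, L Q * μ Q.1 * ν Q.1
      ≤ 2 * ν G.1 ^ (1 / q) * Λ G ^ (1 / s) := by
    intro G _
    rw [hsq]
    refine sum_le_rpow_mul_rpow hqs.symm.lt ν _ G (fun Q hQ => ?_) a _ (fun Q hQ => ?_)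
      fun Q hQ => ?_
    · obtain ⟨h1, h2⟩ := Finset.mem_filter.1 hQ
      exact h2 ▸ hβ Q h1
    · exact ENNReal.mul_ne_top (ENNReal.mul_ne_top (hL Q (Finset.mem_filter.1 hQ).1)
        (Q.measure_ne_top μ)) (Q.measure_ne_top ν)
    · exact sum_mul_le_setLIntegral_kernelBar L μ ν _ Q fun R hR => (Finset.mem_filter.1 hR).2
  have hsum : ∑ G ∈ U.image β, m (α G) ^ s * Λ G ≤ (A * y ^ (1 / p)) ^ s := by
    set φ : (Fin n → ℝ) → ℝ≥0∞ := fun x =>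
      ∑ F ∈ U.image α, F.1.indicator (fun _ => m F ^ p) x with hφ
    set W := wolff s L ν μ with hWdef
    calc ∑ G ∈ U.image β, m (α G) ^ s * Λ G
        = ∑ Q ∈ U, (m (α Q) ^ s * (L Q * ν Q.1 * a Q ^ (s - 1))) * μ Q.1 := by
          refine Eq.trans ?_ (Finset.sum_fiberwise_of_maps_to
            (fun Q hQ => Finset.mem_image_of_mem β hQ) _)
          refine Finset.sum_congr rfl fun G _ => ?_
          rw [hΛ, Finset.mul_sum]
          refine Finset.sum_congr rfl fun Q hQ => ?_
          obtain ⟨h1, h2⟩ := Finset.mem_filter.1 hQ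
          rw [← h2, hαβ Q h1]
          ring
      _ = ∫⁻ x, ∑ Q ∈ U, Q.1.indicator
            (fun _ => m (α Q) ^ s * (L Q * ν Q.1 * a Q ^ (s - 1))) x ∂μ :=
          (lintegral_sum_indicator _ _ _).symm
      -- The levels are pulled out as `φ^{s/p}` and the remaining sum is part of the Wolff
      -- potential; Hölder applies as `s/p + s/r = 1`.
      _ ≤ ∫⁻ x, φ x ^ (s / p) * ((W x ^ (1 / s)) ^ r) ^ (s / r) ∂μ := by
          refine lintegral_mono fun x => ?_
          have e : ((W x ^ (1 / s)) ^ r) ^ (s / r) = W x := by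
            rw [← ENNReal.rpow_mul, ← ENNReal.rpow_mul,
              show 1 / s * (r * (s / r)) = 1 by field_simp, ENNReal.rpow_one]
          rw [e]
          calc ∑ Q ∈ U, Q.1.indicator (fun _ => m (α Q) ^ s * (L Q * ν Q.1 * a Q ^ (s - 1))) x
              ≤ ∑ Q ∈ U, φ x ^ (s / p)
                  * Q.1.indicator (fun _ => L Q * ν Q.1 * a Q ^ (s - 1)) x := by
                refine Finset.sum_le_sum fun Q hQ => ?_
                by_cases hx : x ∈ Q.1
                · rw [Set.indicator_of_mem hx, Set.indicator_of_mem hx]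
                  gcongr
                  rw [show s / p = 1 / p * s by ring, ENNReal.rpow_mul]
                  gcongr
                  exact le_sum_indicator_rpow hp m (Finset.mem_image_of_mem α hQ) (hα Q hQ hx)
                · simp [hx]
            _ = φ x ^ (s / p) * ∑ Q ∈ U, Q.1.indicator (fun _ => L Q * ν Q.1 * a Q ^ (s - 1)) x :=
                (Finset.mul_sum _ _ _).symm
            _ ≤ _ := by
                gcongr
                exact ENNReal.sum_le_tsum _
      _ ≤ (∫⁻ x, φ x ∂μ) ^ (s / p) * (∫⁻ x, (W x ^ (1 / s)) ^ r ∂μ) ^ (s / r) := by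
          refine lintegral_rpow_mul_rpow_le (measurable_sum_indicator _ _)
            (((measurable_wolff _ _ _ _).pow_const _).pow_const _) (by positivity)
            (by positivity) ?_
          have : 1 / p + 1 / r = 1 / s := by linarith
          field_simp at this ⊢
          linarith
      _ ≤ y ^ (s / p) * A ^ s := by
          gcongr
          · exact (lintegral_sum_indicator _ _ _).le
          · rw [show s / r = 1 / r * s by ring, ENNReal.rpow_mul]
            gcongr
      _ = _ := by
          rw [ENNReal.mul_rpow_of_nonneg _ _ hs.le, ← ENNReal.rpow_mul, mul_comm]
          congr 2; ring
  calc ∑ Q ∈ U, L Q * μ Q.1 * ν Q.1 * (m (α Q) * k (β Q))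
      = ∑ G ∈ U.image β, m (α G) * k G * ∑ Q ∈ U with β Q = G, L Q * μ Q.1 * ν Q.1 := by
        rw [← Finset.sum_fiberwise_of_maps_to fun Q hQ => Finset.mem_image_of_mem β hQ]
        refine Finset.sum_congr rfl fun G _ => ?_
        rw [Finset.mul_sum]
        refine Finset.sum_congr rfl fun Q hQ => ?_
        obtain ⟨h1, h2⟩ := Finset.mem_filter.1 hQ
        rw [← h2, hαβ Q h1]
        ring
    _ ≤ ∑ G ∈ U.image β, m (α G) * k G * (2 * ν G.1 ^ (1 / q) * Λ G ^ (1 / s)) :=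
        Finset.sum_le_sum fun G hG => mul_le_mul_right (hT G hG) _
    _ = 2 * ∑ G ∈ U.image β, (k G ^ q * ν G.1) ^ (1 / q) * (m (α G) ^ s * Λ G) ^ (1 / s) := by
        rw [Finset.mul_sum]
        refine Finset.sum_congr rfl fun G _ => ?_
        rw [mul_rpow_one_div hq, mul_rpow_one_div hs]
        ring
    _ ≤ 2 * ((∑ G ∈ U.image β, k G ^ q * ν G.1) ^ (1 / q)
          * (∑ G ∈ U.image β, m (α G) ^ s * Λ G) ^ (1 / s)) := by
        gcongr
        exact sum_rpow_mul_rpow_le _ _ _ (by positivity) (by positivity) (by rw [hsq]; simp)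
    _ ≤ 2 * ((∑ G ∈ U.image β, k G ^ q * ν G.1) ^ (1 / q)
          * ((A * y ^ (1 / p)) ^ s) ^ (1 / s)) := by gcongr
    _ = _ := by
        rw [← ENNReal.rpow_mul, mul_one_div_cancel hs.ne', ENNReal.rpow_one]
        ring

end Sufficiency

/-! ### The trilinear form split by the order of the principal cubes -/

section Trilinear

variable {n : ℕ}

theorem localSum_congr {a b : DyadicCube n → ℝ≥0∞} {Q : DyadicCube n}
    (h : ∀ R : DyadicCube n, R.1 ⊆ Q.1 → a R = b R) : localSum a Q = localSum b Q := by
  funext x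
  exact tsum_congr fun R => by rw [h R.1 R.2]

theorem localKernel_of_subset (K : DyadicCube n → ℝ≥0∞) (μ : Measure (Fin n → ℝ))
    {Q R : DyadicCube n} (h : R.1 ⊆ Q.1) : localKernel K Q μ R = K R * μ R.1 := by
  simp [localKernel, h]

theorem eLpNorm_ofReal_exponent {X E : Type*} [MeasurableSpace X] [ENorm E] {μ : Measure X}
    {p : ℝ} (hp : 0 < p) (f : X → E) :
    eLpNorm f (ENNReal.ofReal p) μ = (∫⁻ x, ‖f x‖ₑ ^ p ∂μ) ^ (1 / p) := by
  rw [eLpNorm_eq_lintegral_rpow_enorm_toReal (by simpa using hp) ENNReal.ofReal_ne_top,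
    ENNReal.toReal_ofReal hp.le]

theorem exponent_pos {x y r : ℝ} (h : 1 / x + 1 / y < 1) (hr : 1 / r + 1 / x + 1 / y = 1) :
    0 < r := one_div_pos.1 (by linarith)

variable {p : Fin 3 → ℝ} {K : DyadicCube n → ℝ≥0} {σ : Fin 3 → Measure (Fin n → ℝ)}

open Classical in
/-- The part of the trilinear sum below one principal cube `F` of the third function. -/
theorem LocalConditionHolds.sum_block_le (hp : ∀ i, 1 < p i)
    [∀ i, IsLocallyFiniteMeasure (σ i)] {c : ℝ≥0} (h : LocalConditionHolds p K σ c)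
    (τ : Equiv.Perm (Fin 3)) (F : DyadicCube n) (U : Finset (DyadicCube n))
    (α β : DyadicCube n → DyadicCube n)
    (hα : ∀ Q ∈ U, Q.1 ⊆ (α Q).1) (hβ : ∀ Q ∈ U, Q.1 ⊆ (β Q).1)
    (hαβ : ∀ Q ∈ U, α (β Q) = α Q) (hF : ∀ Q ∈ U, (α Q).1 ⊆ F.1)
    (m k : DyadicCube n → ℝ≥0∞) :
    ∑ Q ∈ U, K Q * σ (τ 2) Q.1 * σ (τ 0) Q.1 * σ (τ 1) Q.1 * (m (α Q) * k (β Q))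
      ≤ 2 * (c * σ (τ 2) F.1 ^ (1 / p (τ 2)))
        * (∑ G ∈ U.image α, m G ^ p (τ 0) * σ (τ 0) G.1) ^ (1 / p (τ 0))
        * (∑ G ∈ U.image β, k G ^ p (τ 1) * σ (τ 1) G.1) ^ (1 / p (τ 1)) := by
  have hp0 : ∀ i, 0 < p i := fun i => by linarith [hp i]
  have hconj := Real.HolderConjugate.conjExponent (hp (τ 1))
  obtain ⟨hS, hW⟩ := h τ (τ 0) (τ 1) (τ 2) rfl rfl rfl
  rcases le_or_gt 1 (1 / p (τ 0) + 1 / p (τ 1)) with hle | hlt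
  · refine (sum_le_of_sawyer (hp0 _) hconj hle (L := fun R => K R * σ (τ 2) R.1)
      (A := c * σ (τ 2) F.1 ^ (1 / p (τ 2))) U α β hα hβ hαβ m k fun G hG => ?_).trans ?_
    -- The test is made at the stopping cube `G`, and `G ⊆ F` allows `σ_c(G)` to be enlarged to
    -- `σ_c(F)`. In the Wolff case the kernel is localized to `F` itself.
    · have htest := (hS hle G).1
      rw [SawyerTest, localSum_congr (b := fun R => K R * σ (τ 2) R.1 * σ (τ 0) R.1)
        fun R hR => by rw [localKernel_of_subset _ _ hR]] at htest
      refine htest.trans ?_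
      obtain ⟨Q, hQ, rfl⟩ := Finset.mem_image.1 hG
      have := hp0 (τ 2)
      rw [mul_right_comm]
      gcongr
      exact hF Q hQ
    · exact mul_le_mul_left (mul_le_mul_left
        (le_mul_of_one_le_left zero_le one_le_two) _) _
  · set r := 1 / (1 - 1 / p (τ 0) - 1 / p (τ 1)) with hr
    have hr1 : 1 / r + 1 / p (τ 0) + 1 / p (τ 1) = 1 := by rw [hr, one_div_one_div]; ring
    have hr0 := exponent_pos hlt hr1
    have hw := (hW hlt F r hr1).1
    rw [WolffBound, eLpNorm_ofReal_exponent hr0] at hw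
    simp only [enorm_eq_self] at hw
    have hLQ : ∀ Q ∈ U, localKernel (fun S => (K S : ℝ≥0∞)) F (σ (τ 2)) Q
        = K Q * σ (τ 2) Q.1 := fun Q hQ => localKernel_of_subset _ _ ((hα Q hQ).trans (hF Q hQ))
    refine le_trans (le_of_eq (Finset.sum_congr rfl fun Q hQ => ?_)) (sum_le_of_wolff (hp0 _) hr0
      hconj hr1 (L := localKernel (fun S => (K S : ℝ≥0∞)) F (σ (τ 2))) U (fun Q hQ => ?_)
      α β hα hβ hαβ m k hw)
    · rw [hLQ Q hQ]
    · rw [hLQ Q hQ]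
      exact ENNReal.mul_ne_top ENNReal.coe_ne_top (Q.measure_ne_top _)

open Classical in
/-- The part of the trilinear sum over the cubes with a prescribed order of principal cubes. -/
theorem LocalConditionHolds.sum_ordered_le (hp : ∀ i, 1 < p i) (hsum : 1 ≤ ∑ i, 1 / p i)
    [∀ i, IsLocallyFiniteMeasure (σ i)] {c : ℝ≥0} (h : LocalConditionHolds p K σ c)
    (τ : Equiv.Perm (Fin 3)) (S : Finset (DyadicCube n)) (π : Fin 3 → DyadicCube n → DyadicCube n)
    (m : Fin 3 → DyadicCube n → ℝ≥0∞)
    (hπ : ∀ i, ∀ Q ∈ S, π i Q ∈ S ∧ Q.1 ⊆ (π i Q).1)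
    (hcons : ∀ i, ∀ Q ∈ S, ∀ R ∈ S, Q.1 ⊆ R.1 → R.1 ⊆ (π i Q).1 → π i R = π i Q) :
    ∑ Q ∈ S with (π (τ 1) Q).1 ⊆ (π (τ 0) Q).1 ∧ (π (τ 0) Q).1 ⊆ (π (τ 2) Q).1,
        K Q * ∏ i, (σ i Q.1 * m i (π i Q))
      ≤ 2 * c * ∏ i, (∑ F ∈ S.image (π i), m i F ^ p i * σ i F.1) ^ (1 / p i) := by
  have hp0 : ∀ i, 0 < p i := fun i => by linarith [hp i]
  set U := S.filter fun Q => (π (τ 1) Q).1 ⊆ (π (τ 0) Q).1 ∧ (π (τ 0) Q).1 ⊆ (π (τ 2) Q).1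
    with hU
  have hUS : ∀ Q ∈ U, Q ∈ S := fun Q hQ => (Finset.mem_filter.1 hQ).1
  have h10 : ∀ Q ∈ U, (π (τ 1) Q).1 ⊆ (π (τ 0) Q).1 := fun Q hQ => (Finset.mem_filter.1 hQ).2.1
  have h02 : ∀ Q ∈ U, (π (τ 0) Q).1 ⊆ (π (τ 2) Q).1 := fun Q hQ => (Finset.mem_filter.1 hQ).2.2
  have hself : ∀ i, ∀ Q ∈ U, Q.1 ⊆ (π i Q).1 := fun i Q hQ => (hπ i Q (hUS Q hQ)).2
  have hmem : ∀ i, ∀ Q ∈ U, π i Q ∈ S := fun i Q hQ => (hπ i Q (hUS Q hQ)).1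
  -- A principal cube lying between `Q` and a larger principal cube of `Q` has that same larger one:
  -- this is the compatibility `hαβ` of the bilinear blocks.
  have c01 : ∀ Q ∈ U, π (τ 0) (π (τ 1) Q) = π (τ 0) Q := fun Q hQ =>
    hcons _ Q (hUS Q hQ) _ (hmem _ Q hQ) (hself _ Q hQ) (h10 Q hQ)
  have c20 : ∀ Q ∈ U, π (τ 2) (π (τ 0) Q) = π (τ 2) Q := fun Q hQ =>
    hcons _ Q (hUS Q hQ) _ (hmem _ Q hQ) (hself _ Q hQ) (h02 Q hQ)
  have c21 : ∀ Q ∈ U, π (τ 2) (π (τ 1) Q) = π (τ 2) Q := fun Q hQ =>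
    hcons _ Q (hUS Q hQ) _ (hmem _ Q hQ) (hself _ Q hQ) ((h10 Q hQ).trans (h02 Q hQ))
  set T := U.image (π (τ 2)) with hT
  set E : Fin 3 → DyadicCube n → ℝ≥0∞ := fun i F =>
    ∑ G ∈ U.image (π i) with π (τ 2) G = F, m i G ^ p i * σ i G.1 with hE
  have hEle : ∀ i, (∀ Q ∈ U, π (τ 2) (π i Q) = π (τ 2) Q) →
      ∑ F ∈ T, E i F ≤ ∑ F ∈ S.image (π i), m i F ^ p i * σ i F.1 := by
    intro i hi
    rw [hE, Finset.sum_fiberwise_of_maps_to]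
    · exact Finset.sum_le_sum_of_subset (Finset.image_subset_image (Finset.filter_subset _ _))
    · intro G hG
      obtain ⟨Q, hQ, rfl⟩ := Finset.mem_image.1 hG
      rw [hi Q hQ]
      exact Finset.mem_image_of_mem _ hQ
  have hEsub : ∀ i, (∀ Q ∈ U, π (τ 2) (π i Q) = π (τ 2) Q) → ∀ F,
      ∑ G ∈ (U.filter fun Q => π (τ 2) Q = F).image (π i), m i G ^ p i * σ i G.1 ≤ E i F := by
    intro i hi F
    refine Finset.sum_le_sum_of_subset fun G hG => ?_
    obtain ⟨Q, hQ, rfl⟩ := Finset.mem_image.1 hG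
    obtain ⟨hQ1, hQ2⟩ := Finset.mem_filter.1 hQ
    exact Finset.mem_filter.2 ⟨Finset.mem_image_of_mem _ hQ1, (hi Q hQ1).trans hQ2⟩
  have hprod : ∀ x : Fin 3 → ℝ≥0∞, ∏ i, x i = x (τ 0) * x (τ 1) * x (τ 2) := fun x => by
    rw [← Equiv.prod_comp τ, Fin.prod_univ_three]
  have hsum' : 1 ≤ 1 / p (τ 2) + 1 / p (τ 0) + 1 / p (τ 1) := by
    rw [← Equiv.sum_comp τ, Fin.sum_univ_three] at hsum
    linarith
  have := fun i => (hp0 i).le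
  calc ∑ Q ∈ U, K Q * ∏ i, (σ i Q.1 * m i (π i Q))
      = ∑ F ∈ T, m (τ 2) F * ∑ Q ∈ U with π (τ 2) Q = F,
          K Q * σ (τ 2) Q.1 * σ (τ 0) Q.1 * σ (τ 1) Q.1
            * (m (τ 0) (π (τ 0) Q) * m (τ 1) (π (τ 1) Q)) := by
        refine Eq.trans (Finset.sum_fiberwise_of_maps_to
          (fun Q hQ => Finset.mem_image_of_mem (π (τ 2)) hQ) _).symm ?_
        refine Finset.sum_congr rfl fun F _ => ?_
        rw [Finset.mul_sum]
        refine Finset.sum_congr rfl fun Q hQ => ?_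
        rw [hprod, ← (Finset.mem_filter.1 hQ).2]
        ring
    _ ≤ ∑ F ∈ T, m (τ 2) F * (2 * (c * σ (τ 2) F.1 ^ (1 / p (τ 2)))
          * E (τ 0) F ^ (1 / p (τ 0)) * E (τ 1) F ^ (1 / p (τ 1))) := by
        refine Finset.sum_le_sum fun F _ => mul_le_mul_right ?_ _
        have hV : ∀ Q ∈ U.filter (fun Q => π (τ 2) Q = F), Q ∈ U ∧ π (τ 2) Q = F :=
          fun Q hQ => Finset.mem_filter.1 hQ
        refine (h.sum_block_le hp τ F _ (π (τ 0)) (π (τ 1)) (fun Q hQ => hself _ Q (hV Q hQ).1)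
          (fun Q hQ => hself _ Q (hV Q hQ).1) (fun Q hQ => c01 Q (hV Q hQ).1)
          (fun Q hQ => (hV Q hQ).2 ▸ h02 Q (hV Q hQ).1) _ _).trans ?_
        have := hp0 (τ 0)
        have := hp0 (τ 1)
        gcongr
        · exact hEsub _ c20 F
        · exact hEsub _ c21 F
    _ = 2 * c * ∑ F ∈ T, (m (τ 2) F ^ p (τ 2) * σ (τ 2) F.1) ^ (1 / p (τ 2))
          * E (τ 0) F ^ (1 / p (τ 0)) * E (τ 1) F ^ (1 / p (τ 1)) := by
        rw [Finset.mul_sum]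
        refine Finset.sum_congr rfl fun F _ => ?_
        rw [mul_rpow_one_div (hp0 _)]
        ring
    -- This is where `∑ 1/p_i ≥ 1` enters.
    _ ≤ 2 * c * ((∑ F ∈ T, m (τ 2) F ^ p (τ 2) * σ (τ 2) F.1) ^ (1 / p (τ 2))
          * (∑ F ∈ T, E (τ 0) F) ^ (1 / p (τ 0)) * (∑ F ∈ T, E (τ 1) F) ^ (1 / p (τ 1))) := by
        gcongr
        exact sum_rpow_mul_rpow_mul_rpow_le _ _ _ _ (one_div_nonneg.2 (this _))
          (one_div_nonneg.2 (this _)) (one_div_nonneg.2 (this _)) hsum'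
    _ ≤ 2 * c * ((∑ F ∈ S.image (π (τ 2)), m (τ 2) F ^ p (τ 2) * σ (τ 2) F.1) ^ (1 / p (τ 2))
          * (∑ F ∈ S.image (π (τ 0)), m (τ 0) F ^ p (τ 0) * σ (τ 0) F.1) ^ (1 / p (τ 0))
          * (∑ F ∈ S.image (π (τ 1)), m (τ 1) F ^ p (τ 1) * σ (τ 1) F.1) ^ (1 / p (τ 1))) := by
        have := hp0 (τ 0)
        have := hp0 (τ 1)
        have := hp0 (τ 2)
        gcongr
        · exact Finset.image_subset_image (Finset.filter_subset _ _)
        · exact hEle _ c20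
        · exact hEle _ c21
    _ = _ := by rw [hprod]; ring

theorem exists_perm_ordered (B : Fin 3 → DyadicCube n) {Q : DyadicCube n}
    (hB : ∀ i, Q.1 ⊆ (B i).1) :
    ∃ τ : Equiv.Perm (Fin 3), (B (τ 1)).1 ⊆ (B (τ 0)).1 ∧ (B (τ 0)).1 ⊆ (B (τ 2)).1 := by
  have key : ∀ i j, (B i).1 ⊆ (B j).1 ∨ (B j).1 ⊆ (B i).1 := fun i j =>
    DyadicCube.subset_or_subset_of_subset (hB i) (hB j)
  have mk : ∀ i j k : Fin 3, Function.Bijective ![j, i, k] → (B i).1 ⊆ (B j).1 →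
      (B j).1 ⊆ (B k).1 →
      ∃ τ : Equiv.Perm (Fin 3), (B (τ 1)).1 ⊆ (B (τ 0)).1 ∧ (B (τ 0)).1 ⊆ (B (τ 2)).1 :=
    fun i j k hb h1 h2 => ⟨Equiv.ofBijective _ hb, by simpa using h1, by simpa using h2⟩
  rcases key 0 1 with h01 | h10
  · rcases key 1 2 with h12 | h21
    · exact mk 0 1 2 (by decide) h01 h12
    · rcases key 0 2 with h02 | h20
      · exact mk 0 2 1 (by decide) h02 h21
      · exact mk 2 0 1 (by decide) h20 h01
  · rcases key 0 2 with h02 | h20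
    · exact mk 1 0 2 (by decide) h10 h02
    · rcases key 1 2 with h12 | h21
      · exact mk 1 2 0 (by decide) h12 h20
      · exact mk 2 1 0 (by decide) h21 h10

/-- The trilinear embedding inequality with constant `A`, for nonnegative functions. -/
def NonnegEmbedding (p : Fin 3 → ℝ) (K : DyadicCube n → ℝ≥0) (σ : Fin 3 → Measure (Fin n → ℝ))
    (A : ℝ≥0∞) : Prop :=
  ∀ f : Fin 3 → (Fin n → ℝ) → ℝ≥0∞, (∀ i, Measurable (f i)) →
    (∀ i, ∫⁻ x, f i x ^ p i ∂(σ i) ≠ ∞) →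
      ∑' Q : DyadicCube n, (K Q : ℝ≥0∞) * ∏ i, ∫⁻ x in Q.1, f i x ∂(σ i)
        ≤ A * ∏ i, (∫⁻ x, f i x ^ p i ∂(σ i)) ^ (1 / p i)

/-- The constant in the sufficiency of the localized condition. -/
def sufficiencyConst (p : Fin 3 → ℝ) : ℝ≥0∞ :=
  96 * ∏ i, carlesonConst (p i) ^ (1 / p i)

theorem sufficiencyConst_ne_top (hp : ∀ i, 1 < p i) : sufficiencyConst p ≠ ∞ :=
  ENNReal.mul_ne_top (by norm_num) (ENNReal.prod_ne_top fun i _ =>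
    ENNReal.rpow_ne_top_of_nonneg (one_div_nonneg.2 (by linarith [hp i]))
      (carlesonConst_ne_top (hp i)))

theorem LocalConditionHolds.nonnegEmbedding (hp : ∀ i, 1 < p i) (hsum : 1 ≤ ∑ i, 1 / p i)
    [∀ i, IsLocallyFiniteMeasure (σ i)] {c : ℝ≥0} (h : LocalConditionHolds p K σ c) :
    NonnegEmbedding p K σ (sufficiencyConst p * c) := by
  classical
  intro f hf hfin
  rw [ENNReal.tsum_eq_iSup_sum]
  refine iSup_le fun S₀ => ?_
  -- Cubes with a vanishing integral contribute nothing, and the others have nonzero averages, as a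
  -- binary order requires.
  set S := S₀.filter fun Q => ∀ i, ∫⁻ x in Q.1, f i x ∂(σ i) ≠ 0 with hS
  have hS0 : ∀ i, ∀ Q ∈ S, ∫⁻ x in Q.1, f i x ∂(σ i) ≠ 0 := fun i Q hQ =>
    (Finset.mem_filter.1 hQ).2 i
  choose π m h1 h2 h3 using fun i =>
    exists_principal_carleson (σ i) (hp i) (hf i) (hfin i) S (hS0 i)
  have hπ : ∀ i, ∀ Q ∈ S, π i Q ∈ S ∧ Q.1 ⊆ (π i Q).1 := fun i Q hQ =>
    ⟨(h1 i Q hQ).1, (h1 i Q hQ).2.1⟩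
  set B : ℝ≥0∞ := ∏ i, (∫⁻ x, f i x ^ p i ∂(σ i)) ^ (1 / p i) with hB
  have hcarl : ∏ i, (∑ F ∈ S.image (π i), m i F ^ p i * σ i F.1) ^ (1 / p i)
      ≤ (∏ i, carlesonConst (p i) ^ (1 / p i)) * B := by
    rw [hB, ← Finset.prod_mul_distrib]
    refine Finset.prod_le_prod' fun i _ => ?_
    have hi : 0 ≤ 1 / p i := one_div_nonneg.2 (by linarith [hp i])
    rw [← ENNReal.mul_rpow_of_nonneg _ _ hi]
    refine ENNReal.rpow_le_rpow (h3 i _ fun F hF => ?_) hi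
    simpa using hF
  set P : Equiv.Perm (Fin 3) → DyadicCube n → Prop := fun τ Q =>
    (π (τ 1) Q).1 ⊆ (π (τ 0) Q).1 ∧ (π (τ 0) Q).1 ⊆ (π (τ 2) Q).1 with hP
  set g : DyadicCube n → ℝ≥0∞ := fun Q => K Q * ∏ i, (σ i Q.1 * m i (π i Q)) with hg
  calc ∑ Q ∈ S₀, (K Q : ℝ≥0∞) * ∏ i, ∫⁻ x in Q.1, f i x ∂(σ i)
      = ∑ Q ∈ S, (K Q : ℝ≥0∞) * ∏ i, ∫⁻ x in Q.1, f i x ∂(σ i) := by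
        refine (Finset.sum_filter_of_ne fun Q _ hne i h0 => hne ?_).symm
        rw [Finset.prod_eq_zero (Finset.mem_univ i) h0, mul_zero]
    _ ≤ ∑ Q ∈ S, 8 * g Q := by
        refine Finset.sum_le_sum fun Q hQ => ?_
        have hle : ∏ i, ∫⁻ x in Q.1, f i x ∂(σ i) ≤ ∏ i, 2 * (σ i Q.1 * m i (π i Q)) := by
          refine Finset.prod_le_prod' fun i _ => ?_
          rw [← average_mul_measure, mul_comm (σ i Q.1), ← mul_assoc]
          exact mul_le_mul_left (h1 i Q hQ).2.2 _
        refine (mul_le_mul_right hle _).trans_eq ?_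
        rw [Finset.prod_mul_distrib, hg]
        simp only [Finset.prod_const, Finset.card_univ, Fintype.card_fin]
        rw [mul_left_comm]
        norm_num
    _ ≤ ∑ Q ∈ S, 8 * ∑ τ : Equiv.Perm (Fin 3), if P τ Q then g Q else 0 := by
        refine Finset.sum_le_sum fun Q hQ => mul_le_mul_right ?_ _
        obtain ⟨τ, hτ⟩ := exists_perm_ordered (fun i => π i Q) fun i => (hπ i Q hQ).2
        have hτ' : P τ Q := hτ
        refine le_trans ?_ (Finset.single_le_sum (f := fun τ => if P τ Q then g Q else 0)
          (fun _ _ => bot_le) (Finset.mem_univ τ))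
        simp [hτ']
    _ = 8 * ∑ τ : Equiv.Perm (Fin 3), ∑ Q ∈ S with P τ Q, g Q := by
        rw [← Finset.mul_sum, Finset.sum_comm]
        simp only [Finset.sum_filter]
    _ ≤ 8 * ∑ _τ : Equiv.Perm (Fin 3), 2 * c * ((∏ i, carlesonConst (p i) ^ (1 / p i)) * B) := by
        gcongr with τ
        refine (h.sum_ordered_le hp hsum τ S π m hπ h2).trans ?_
        gcongr
    -- The constant is `96 = 8 · 6 · 2`: a factor `2` for each of three averages, six orderings, and
    -- the `2` of a block.
    _ = _ := by
        rw [Finset.sum_const, Finset.card_univ, Fintype.card_perm, Fintype.card_fin,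
          sufficiencyConst, nsmul_eq_mul]
        norm_num [Nat.factorial]
        ring

end Trilinear

/-! ### Nonnegative functions, transfer of conditions and least constants -/

section Equivalence

variable {n : ℕ} {p : Fin 3 → ℝ} {K : DyadicCube n → ℝ≥0} {σ : Fin 3 → Measure (Fin n → ℝ)}

theorem NonnegEmbedding.embeddingHolds (𝕜 : Type*) [RCLike 𝕜] (hp : ∀ i, 1 < p i) {c : ℝ≥0}
    (h : NonnegEmbedding p K σ c) : EmbeddingHolds 𝕜 p K σ c := by
  intro f hf
  have hp0 : ∀ i, 0 < p i := fun i => by linarith [hp i]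
  have hm : ∀ i, AEMeasurable (fun x => ‖f i x‖ₑ) (σ i) := fun i => (hf i).1.enorm
  have hnorm : ∀ i, eLpNorm (f i) (ENNReal.ofReal (p i)) (σ i)
      = (∫⁻ x, (hm i).mk _ x ^ p i ∂(σ i)) ^ (1 / p i) := fun i => by
    rw [eLpNorm_ofReal_exponent (hp0 i)]
    congr 1
    exact lintegral_congr_ae ((hm i).ae_eq_mk.fun_comp (· ^ p i))
  have hfin : ∀ i, ∫⁻ x, (hm i).mk _ x ^ p i ∂(σ i) ≠ ∞ := fun i hi => by
    have := (hf i).2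
    rw [hnorm, hi, ENNReal.top_rpow_of_pos (by have := hp0 i; positivity)] at this
    exact lt_irrefl _ this
  refine le_trans (ENNReal.tsum_le_tsum fun Q => ?_)
    ((h (fun i => (hm i).mk _) (fun i => (hm i).measurable_mk) hfin).trans_eq ?_)
  · refine mul_le_mul_right (Finset.prod_le_prod' fun i _ => ?_) _
    refine (enorm_integral_le_lintegral_enorm _).trans_eq ?_
    exact lintegral_congr_ae (ae_restrict_of_ae (hm i).ae_eq_mk)
  · simp only [hnorm]

theorem EmbeddingHolds.nonnegEmbedding {𝕜 : Type*} [RCLike 𝕜] (hp : ∀ i, 1 < p i)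
    [∀ i, IsLocallyFiniteMeasure (σ i)] {c : ℝ≥0} (h : EmbeddingHolds 𝕜 p K σ c) :
    NonnegEmbedding p K σ c := by
  intro f hf hfin
  have hp0 : ∀ i, 0 < p i := fun i => by linarith [hp i]
  -- Finiteness of `∫ f^p` confines the value `∞` to a null set, so `toReal` loses nothing.
  have hlt : ∀ i, ∀ᵐ x ∂(σ i), f i x < ∞ := fun i => by
    filter_upwards [ae_lt_top ((hf i).pow_const _) (hfin i)] with x hx
    exact (ENNReal.rpow_lt_top_iff_of_pos (hp0 i)).1 hx
  set F : Fin 3 → (Fin n → ℝ) → 𝕜 := fun i x => ((f i x).toReal : 𝕜) with hF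
  have henorm : ∀ i, ∀ᵐ x ∂(σ i), ‖F i x‖ₑ = f i x := fun i => by
    filter_upwards [hlt i] with x hx
    rw [hF, ← ofReal_norm, RCLike.norm_ofReal, abs_of_nonneg ENNReal.toReal_nonneg,
      ENNReal.ofReal_toReal hx.ne]
  have hnorm : ∀ i, eLpNorm (F i) (ENNReal.ofReal (p i)) (σ i)
      = (∫⁻ x, f i x ^ p i ∂(σ i)) ^ (1 / p i) := fun i => by
    rw [eLpNorm_ofReal_exponent (hp0 i)]
    congr 1
    refine lintegral_congr_ae ?_
    filter_upwards [henorm i] with x hx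
    rw [hx]
  have hmem : ∀ i, MemLp (F i) (ENNReal.ofReal (p i)) (σ i) := fun i => by
    refine ⟨(RCLike.continuous_ofReal.measurable.comp
      (hf i).ennreal_toReal).aestronglyMeasurable, ?_⟩
    rw [hnorm]
    exact ENNReal.rpow_lt_top_of_nonneg (one_div_nonneg.2 (hp0 i).le) (hfin i)
  have hint : ∀ i (Q : DyadicCube n),
      ‖∫ x in Q.1, F i x ∂(σ i)‖ₑ = ∫⁻ x in Q.1, f i x ∂(σ i) := fun i Q => by
    rw [hF, integral_ofReal, integral_toReal (hf i).aemeasurable (ae_restrict_of_ae (hlt i)),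
      ← ofReal_norm, RCLike.norm_ofReal, abs_of_nonneg ENNReal.toReal_nonneg,
      ENNReal.ofReal_toReal (setLIntegral_ne_top_of_rpow (hf i) (hp i) (hfin i) Q)]
  have := h F hmem
  simpa only [hint, hnorm] using this

/-- The third function is `1_Q`: its integral over `R ⊆ Q` is `σ_c(R)`, and the localized kernel
discards the other cubes. -/
theorem NonnegEmbedding.bilinearEmbedding (hp : ∀ i, 1 < p i)
    [∀ i, IsLocallyFiniteMeasure (σ i)] {A : ℝ≥0∞} (h : NonnegEmbedding p K σ A)
    (τ : Equiv.Perm (Fin 3)) (Q : DyadicCube n) :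
    BilinearEmbedding (p (τ 0)) (p (τ 1)) (localKernel (fun S => (K S : ℝ≥0∞)) Q (σ (τ 2)))
      (σ (τ 0)) (σ (τ 1)) (A * σ (τ 2) Q.1 ^ (1 / p (τ 2))) := by
  intro f g hf hg hfin hgfin
  set u : Fin 3 → (Fin n → ℝ) → ℝ≥0∞ := ![f, g, Q.1.indicator fun _ => 1] with hu
  have hprod : ∀ x : Fin 3 → ℝ≥0∞, ∏ i, x i = x (τ 0) * x (τ 1) * x (τ 2) := fun x => by
    rw [← Equiv.prod_comp τ, Fin.prod_univ_three]
  have hind : Measurable (Q.1.indicator fun _ => (1 : ℝ≥0∞)) :=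
    measurable_const.indicator Q.measurableSet
  have hpow : ∫⁻ x, (Q.1.indicator (fun _ => (1 : ℝ≥0∞)) x) ^ p (τ 2) ∂(σ (τ 2))
      = σ (τ 2) Q.1 := by
    rw [← lintegral_indicator_one Q.measurableSet]
    refine lintegral_congr fun x => ?_
    have := hp (τ 2)
    by_cases hx : x ∈ Q.1
    · simp [hx]
    · simp [hx, show 0 < p (τ 2) by linarith]
  have hmeas : ∀ j, Measurable (u j) := by
    simp [hu, Fin.forall_fin_succ, hf, hg, hind]
  have hfin' : ∀ j, ∫⁻ x, u j x ^ p (τ j) ∂(σ (τ j)) ≠ ∞ := by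
    intro j
    fin_cases j
    · exact hfin
    · exact hgfin
    · exact hpow ▸ Q.measure_ne_top _
  have key := h (fun i => u (τ.symm i)) (fun i => hmeas _) (fun i => by
    have := hfin' (τ.symm i)
    rwa [Equiv.apply_symm_apply] at this)
  simp only [hprod, Equiv.symm_apply_apply] at key
  have e0 : u 0 = f := rfl
  have e1 : u 1 = g := rfl
  have e2 : u 2 = Q.1.indicator fun _ => 1 := rfl
  rw [e0, e1, e2, hpow] at key
  refine le_trans (ENNReal.tsum_le_tsum fun R => ?_) (key.trans_eq (by ring))
  by_cases hR : R.1 ⊆ Q.1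
  · rw [localKernel_of_subset _ _ hR, lintegral_indicator_const Q.measurableSet,
      Measure.restrict_apply Q.measurableSet, Set.inter_eq_self_of_subset_right hR]
    exact le_of_eq (by ring)
  · simp [localKernel, hR]

/-- The constant in the necessity of the localized condition. -/
def necessityConst (p : Fin 3 → ℝ) : ℝ≥0 :=
  1 + ∑ a, ∑ b, (wolffConst (p b).conjExponent (p a / (p b).conjExponent)
    ^ (1 / (p b).conjExponent)).toNNReal

/-- For `1/p_a + 1/p_b < 1` one has `p_a > p_b'`, so the term is finite and survives `toNNReal`.
Infinite terms for other pairs become `0` and are never used. -/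
theorem wolffConst_le_necessityConst (hp : ∀ i, 1 < p i) {a b : Fin 3}
    (h : 1 / p a + 1 / p b < 1) :
    wolffConst (p b).conjExponent (p a / (p b).conjExponent) ^ (1 / (p b).conjExponent)
      ≤ necessityConst p := by
  have hconj := Real.HolderConjugate.conjExponent (hp b)
  have hs := hconj.symm.pos
  have hlt : 1 < p a / (p b).conjExponent := by
    rw [one_lt_div hs]
    refine (one_div_lt_one_div (by linarith [hp a]) hs).1 ?_
    have := hconj.inv_add_inv_eq_one
    simp only [one_div] at h ⊢
    linarith
  rw [← ENNReal.coe_toNNReal (ENNReal.rpow_ne_top_of_nonneg (one_div_nonneg.2 hs.le)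
    (wolffConst_ne_top hconj.symm.lt hlt)), ENNReal.coe_le_coe, necessityConst]
  refine le_trans ?_ (le_add_of_nonneg_left zero_le_one)
  refine le_trans ?_ (Finset.single_le_sum (f := fun a => ∑ b,
    (wolffConst (p b).conjExponent (p a / (p b).conjExponent)
      ^ (1 / (p b).conjExponent)).toNNReal) (fun _ _ => bot_le) (Finset.mem_univ a))
  exact Finset.single_le_sum (f := fun b =>
    (wolffConst (p b).conjExponent (p a / (p b).conjExponent)
      ^ (1 / (p b).conjExponent)).toNNReal) (fun _ _ => bot_le) (Finset.mem_univ b)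

theorem NonnegEmbedding.localConditionHolds (hp : ∀ i, 1 < p i)
    [∀ i, IsLocallyFiniteMeasure (σ i)] {c : ℝ≥0} (h : NonnegEmbedding p K σ c) :
    LocalConditionHolds p K σ (necessityConst p * c) := by
  have hp0 : ∀ i, 0 < p i := fun i => by linarith [hp i]
  have hone : (1 : ℝ≥0∞) ≤ necessityConst p := by
    rw [← ENNReal.coe_one, ENNReal.coe_le_coe, necessityConst]
    exact le_self_add
  have sawyer : ∀ (τ : Equiv.Perm (Fin 3)) Q,
      SawyerTest p K σ (necessityConst p * c) (τ 0) (τ 1) (τ 2) Q := by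
    intro τ Q
    refine ((h.bilinearEmbedding hp τ Q).lintegral_localSum_le (hp0 _)
      (Real.HolderConjugate.conjExponent (hp _)) Q).trans ?_
    rw [ENNReal.coe_mul, mul_right_comm]
    gcongr
    exact le_mul_of_one_le_left zero_le hone
  have wolff : ∀ (τ : Equiv.Perm (Fin 3)) Q (r : ℝ), 1 / p (τ 0) + 1 / p (τ 1) < 1 →
      1 / r + 1 / p (τ 0) + 1 / p (τ 1) = 1 →
      WolffBound p K σ (necessityConst p * c) r (τ 0) (τ 1) (τ 2) Q := by
    intro τ Q r hlt hr
    have hr0 := exponent_pos hlt hr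
    rw [WolffBound, eLpNorm_ofReal_exponent hr0]
    simp only [enorm_eq_self]
    refine ((h.bilinearEmbedding hp τ Q).lintegral_wolff_rpow_le (hp0 _) hr0
      (Real.HolderConjugate.conjExponent (hp _)) hr (ENNReal.mul_ne_top ENNReal.coe_ne_top
        (ENNReal.rpow_ne_top_of_nonneg (one_div_nonneg.2 (hp0 _).le)
          (Q.measure_ne_top _)))).trans ?_
    rw [ENNReal.coe_mul, mul_assoc]
    gcongr
    exact wolffConst_le_necessityConst hp hlt
  rintro τ a b c rfl rfl rfl
  -- The second inequality of each pair is the first one for the permutation with `a` and `b`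
  -- exchanged.
  have e0 : ((Equiv.swap 0 1).trans τ) 0 = τ 1 := by simp
  have e1 : ((Equiv.swap 0 1).trans τ) 1 = τ 0 := by simp
  have e2 : ((Equiv.swap 0 1).trans τ) 2 = τ 2 := by
    simp [Equiv.swap_apply_of_ne_of_ne]
  refine ⟨fun _ Q => ⟨sawyer τ Q, ?_⟩, fun hlt Q r hr => ⟨wolff τ Q r hlt hr, ?_⟩⟩
  · have := sawyer ((Equiv.swap 0 1).trans τ) Q
    rwa [e0, e1, e2] at this
  · have := wolff ((Equiv.swap 0 1).trans τ) Q r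
    rw [e0, e1, e2] at this
    exact this (by linarith) (by linarith)

/-- For finite `Y` the map `c ↦ c * Y` is continuous, so the admissible constants form a closed set
containing the infimum; for `Y = ∞` continuity fails at `c = 0`. -/
theorem le_sInf_mul {s : Set ℝ≥0} (hs : s.Nonempty) {X Y : ℝ≥0∞} (hY : Y ≠ ∞)
    (h : ∀ c ∈ s, X ≤ c * Y) : X ≤ (sInf s : ℝ≥0) * Y := by
  have hclosed : IsClosed {c : ℝ≥0 | X ≤ c * Y} :=
    isClosed_le continuous_const ((ENNReal.continuous_mul_const hY).comp ENNReal.continuous_coe)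
  exact hclosed.closure_subset_iff.2 h (csInf_mem_closure hs (OrderBot.bddBelow s))

theorem isLeast_embeddingHolds {𝕜 : Type*} [RCLike 𝕜]
    (hs : {c | EmbeddingHolds 𝕜 p K σ c}.Nonempty) :
    IsLeast {c | EmbeddingHolds 𝕜 p K σ c} (sInf {c | EmbeddingHolds 𝕜 p K σ c}) :=
  ⟨fun f hf => le_sInf_mul hs (ENNReal.prod_ne_top fun i _ => (hf i).2.ne) fun _ hc => hc f hf,
    fun _ hc => csInf_le (OrderBot.bddBelow _) hc⟩

theorem isLeast_localConditionHolds (hp : ∀ i, 1 < p i) [∀ i, IsLocallyFiniteMeasure (σ i)]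
    (hs : {c | LocalConditionHolds p K σ c}.Nonempty) :
    IsLeast {c | LocalConditionHolds p K σ c} (sInf {c | LocalConditionHolds p K σ c}) := by
  have hpow : ∀ i (Q : DyadicCube n), σ i Q.1 ^ (1 / p i) ≠ ∞ := fun i Q =>
    ENNReal.rpow_ne_top_of_nonneg (one_div_nonneg.2 (by linarith [hp i])) (Q.measure_ne_top _)
  refine ⟨fun τ a b c ha hb hc => ⟨fun hle Q => ⟨?_, ?_⟩, fun hlt Q r hr => ⟨?_, ?_⟩⟩,
    fun _ hc => csInf_le (OrderBot.bddBelow _) hc⟩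
  · rw [SawyerTest, mul_assoc]
    refine le_sInf_mul hs (ENNReal.mul_ne_top (hpow _ _) (hpow _ _)) fun C hC => ?_
    rw [← mul_assoc]
    exact ((hC τ a b c ha hb hc).1 hle Q).1
  · rw [SawyerTest, mul_assoc]
    refine le_sInf_mul hs (ENNReal.mul_ne_top (hpow _ _) (hpow _ _)) fun C hC => ?_
    rw [← mul_assoc]
    exact ((hC τ a b c ha hb hc).1 hle Q).2
  · exact le_sInf_mul hs (hpow _ _) fun C hC => ((hC τ a b c ha hb hc).2 hlt Q r hr).1
  · exact le_sInf_mul hs (hpow _ _) fun C hC => ((hC τ a b c ha hb hc).2 hlt Q r hr).2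

end Equivalence

end TrilinearEmbedding

end

open TrilinearEmbedding in
theorem theorem1p3 (𝕜 : Type*) [RCLike 𝕜] (p : Fin 3 → ℝ) (hp : ∀ i, 1 < p i)
    (hsum : 1 ≤ ∑ i, 1 / p i) :
    ∃ C : ℝ≥0, ∀ (n : ℕ) (K : DyadicCube n → ℝ≥0) (σ : Fin 3 → Measure (Fin n → ℝ)),
      (∀ i, IsLocallyFiniteMeasure (σ i)) →
        ((∃ c₁ : ℝ≥0, EmbeddingHolds 𝕜 p K σ c₁) ↔
          (∃ c₂ : ℝ≥0, LocalConditionHolds p K σ c₂)) ∧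
        ((∃ c₁ : ℝ≥0, EmbeddingHolds 𝕜 p K σ c₁) →
          ∃ c₁ c₂ : ℝ≥0, IsLeast {c | EmbeddingHolds 𝕜 p K σ c} c₁ ∧
            IsLeast {c | LocalConditionHolds p K σ c} c₂ ∧ c₁ ≤ C * c₂ ∧ c₂ ≤ C * c₁) := by
  refine ⟨max (sufficiencyConst p).toNNReal (necessityConst p), fun n K σ hσ => ?_⟩
  have hab : ∀ c, EmbeddingHolds 𝕜 p K σ c → LocalConditionHolds p K σ (necessityConst p * c) :=
    fun c h => (h.nonnegEmbedding hp).localConditionHolds hp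
  have hba : ∀ c, LocalConditionHolds p K σ c →
      EmbeddingHolds 𝕜 p K σ ((sufficiencyConst p).toNNReal * c) := fun c h => by
    refine NonnegEmbedding.embeddingHolds 𝕜 hp ?_
    rw [ENNReal.coe_mul, ENNReal.coe_toNNReal (sufficiencyConst_ne_top hp)]
    exact h.nonnegEmbedding hp hsum
  refine ⟨⟨fun ⟨c, h⟩ => ⟨_, hab c h⟩, fun ⟨c, h⟩ => ⟨_, hba c h⟩⟩, fun ⟨c, h⟩ => ?_⟩
  have h₁ := isLeast_embeddingHolds ⟨c, h⟩
  have h₂ := isLeast_localConditionHolds hp ⟨_, hab c h⟩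
  -- Each least constant, transferred to the other side, is admissible there and so dominates the
  -- other least constant.
  refine ⟨_, _, h₁, h₂, (h₁.2 (hba _ h₂.1)).trans ?_, (h₂.2 (hab _ h₁.1)).trans ?_⟩
  · gcongr
    exact le_max_left _ _
  · gcongr
    exact le_max_right _ _
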